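/- Let $a,b\in\mathbb{C}$, $0<\lambda<\infty$, $0<\theta<\pi$ with $\lambda\theta<2\pi$, and $\mu<1$. Let $f$ be an entire function such that, as $|z|\to\infty$, \[ f(z)=\begin{cases} z^a(\log z)^b\exp(z^\lambda)\,[1+o(1)] & \text{for } |\arg z|\le\theta,\\ O\!\left(\exp(\mu|z|^\lambda)\right) & \text{for } |\arg z|>\theta,\end{cases} \] each estimate holding uniformly in its sector. Here and below $\arg z\in(-\pi,\pi]$, and logarithms and powers are principal. Put \[ p_{n-1}(z)=\sum_{k=0}^{n-1}\frac{f^{(k)}(0)}{k!}z^k,\qquad r_n=\left(\frac n\lambda\right)^{1/\lambda}. \] For a point $z_0\ne0$ with $|\arg z_0|<\theta$, let us say that zeros $z_k$ approach $z_0$ if there are integers $n_k\to\infty$ with $p_{n_k-1}(r_{n_k}z_k)=0$ for all $k$ and $z_k\to z_0$; $z_0$ is a limit point of the zeros of $p_{n-1}(r_nz)$ if such $n_k,z_k$ exist. (1) Every limit point $z_0$ of the zeros of $p_{n-1}(r_nz)$ with $|\arg z_0|<\theta$, $z_0\neq0$ lies on the curve \[ \left|z^\lambda\exp(1-z^\lambda)\right|=1,\qquad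 |z|\le1 . \] (2) The zeros approach this curve from the region $|z^\lambda\exp(1-z^\lambda)|>1$: whenever zeros $z_k$ approach a point $z_0\ne0$ with $|\arg z_0|<\theta$, one has $|z_k^\lambda\exp(1-z_k^\lambda)|>1$ for all sufficiently large $k$. (3) Whenever zeros $z_k$ (with indices $n_k$) approach a point $z_0\neq0,1$ with $|\arg z_0|<\theta$, \[ \left|z_k^\lambda\exp(1-z_k^\lambda)\right|=1+\frac{\lambda\log n_k}{2n_k}+O\!\left(\frac1{n_k}\right)\qquad(k\to\infty). \] -/

import Mathlib

open Filter Topology Asymptotics Bornology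

/-- The Maclaurin partial sum `p_{n-1}(z) = ∑_{k ≤ n-1} f^{(k)}(0)/k! * z^k`
(the sum has exactly `n` terms). -/
noncomputable def maclaurinSum (f : ℂ → ℂ) (n : ℕ) (z : ℂ) : ℂ :=
  ∑ k ∈ Finset.range n, iteratedDeriv k f 0 / (Nat.factorial k : ℂ) * z ^ k

/-- The scaling radius `r_n = (n/lam)^(1/lam)`. -/
noncomputable def scaleRadius (lam : ℝ) (n : ℕ) : ℝ :=
  ((n : ℝ) / lam) ^ (1 / lam)

/-- `|z^lam * exp (1 - z^lam)|`, with the principal branch of the power. -/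
noncomputable def curveModulus (lam : ℝ) (z : ℂ) : ℝ :=
  ‖z ^ (lam : ℂ) * Complex.exp (1 - z ^ (lam : ℂ))‖

/-- The limit curve `|z^lam * exp (1 - z^lam)| = 1`, `|z| ≤ 1`. -/
def limitCurve (lam : ℝ) : Set ℂ :=
  {z | curveModulus lam z = 1 ∧ ‖z‖ ≤ 1}

/-- `f` is entire with a single sector `|arg z| ≤ θ` of maximal exponential growth:
`f z = z^a (log z)^b exp (z^lam) (1 + o(1))` for `|arg z| ≤ θ` and
`f z = O(exp (μ |z|^lam))` for `|arg z| > θ`, as `|z| → ∞`, uniformly in each sector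
(principal branches). -/
structure OneDirectionGrowth (a b : ℂ) (lam θ μ : ℝ) (f : ℂ → ℂ) : Prop where
  entire : Differentiable ℂ f
  sector : f ~[cobounded ℂ ⊓ 𝓟 {z : ℂ | |Complex.arg z| ≤ θ}]
    fun z => z ^ a * Complex.log z ^ b * Complex.exp (z ^ (lam : ℂ))
  outside : f =O[cobounded ℂ ⊓ 𝓟 {z : ℂ | θ < |Complex.arg z|}]
    fun z => Real.exp (μ * ‖z‖ ^ lam)

/-- `z k` is a zero of the scaled partial sum `w ↦ p_{n-1}(r_n w)` with `n = n k`, where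
`n k → ∞`, and `z k → z₀`. -/
def ZerosTendTo (f : ℂ → ℂ) (lam : ℝ) (n : ℕ → ℕ) (z : ℕ → ℂ) (z₀ : ℂ) : Prop :=
  Tendsto n atTop atTop ∧
    (∀ k, maclaurinSum f (n k) ((scaleRadius lam (n k) : ℂ) * z k) = 0) ∧
    Tendsto z atTop (𝓝 z₀)

/-- `z₀` is a limit point, as `n → ∞`, of the zeros of the scaled partial sums. -/
def IsZeroLimitPoint (f : ℂ → ℂ) (lam : ℝ) (z₀ : ℂ) : Prop :=
  ∃ (n : ℕ → ℕ) (z : ℕ → ℂ), ZerosTendTo f lam n z z₀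

/-! Summing the geometric series under Cauchy's coefficient formula turns the partial sum into `f`
(inside the contour) or `0` (outside), minus a Cauchy-type integral of `f ζ / ζ ^ n`. After
rescaling by `r_n`, this integrand has a saddle point at `s = 1`: on the circle `s = exp ((η + i x)
/ √n)` it tends, once normalised, to the Gaussian `exp (lam (η + i x)² / 2)`. The growth hypotheses
supply a Gaussian majorant uniform in `n`: in the sector because `cos (lam t)` stays below `1 - c
t²` when `lam θ < 2π`, outside it because `μ < 1` leaves an exponential deficit. Dominated
convergence then evaluates the Cauchy integral `J`. It behaves like a nonzero constant over `√n (1 -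
z)` when `√n |1 - z| → ∞`, and tends to a Gaussian Cauchy transform when `√n (z - 1)` converges.

A zero outside the contour makes `J` vanish. With `η = 0` both limits are nonzero, so zeros near a
fixed point satisfy `|z| < exp (ξ / √n)` eventually, for every `ξ > 0`. Hence a contour with `η > 0`
passes outside them, and there `J` equals `f (r_n z)` over its normalised power. By the asymptotics
of `f` in the sector, `|J| * curveModulus ^ (n / lam)` tends to `|z₀ ^ a|`.

For `z₀ ≠ 1` the size of `J` gives `curveModulus ^ (n / lam) ~ B √n |1 - z|`. Taking logarithms
yields the expansion, and with it the limit curve. At `z₀ = 1` the bound `|J| ≤ M < 1` on a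
well-chosen contour is enough to force `curveModulus > 1`. -/

section PartialSums

/-! ### Contour integral for the partial sum. -/

open MeasureTheory Metric

/-- The Maclaurin partial sum as a contour integral over a circle that avoids the argument. -/
theorem maclaurinSum_eq_sub_circleIntegral {f : ℂ → ℂ} (hf : Differentiable ℂ f) (n : ℕ) {R : ℝ}
    (hR : 0 < R) {w : ℂ} (hw : ‖w‖ ≠ R) :
    maclaurinSum f n w = (if ‖w‖ < R then f w else 0) -
      (2 * Real.pi * Complex.I)⁻¹ *
        ∮ ζ in C(0, R), f ζ * w ^ n / (ζ ^ n * (ζ - w)) := by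
  have hpi : (2 * Real.pi * Complex.I : ℂ) ≠ 0 := Complex.two_pi_I_ne_zero
  have hsph : ∀ ζ ∈ sphere (0 : ℂ) R, ζ ≠ 0 ∧ ζ - w ≠ 0 := by
    intro ζ hζ
    have hζ' : ‖ζ‖ = R := by simpa using hζ
    refine ⟨fun h => ?_, fun h => hw ?_⟩
    · rw [h, norm_zero] at hζ'; exact hR.ne hζ'
    · rw [← sub_eq_zero.1 h, hζ']
  have hcont : ∀ g : ℂ → ℂ, ContinuousOn g (sphere (0 : ℂ) R) → CircleIntegrable g 0 R :=
    fun g hg => hg.circleIntegrable hR.le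
  have hcauchy : (∮ ζ in C(0, R), f ζ / (ζ - w)) =
      (2 * Real.pi * Complex.I) * (if ‖w‖ < R then f w else 0) := by
    split_ifs with h
    · have := hf.differentiableOn.circleIntegral_sub_inv_smul
        (c := 0) (R := R) (w := w) (by simpa using h)
      simpa [div_eq_inv_mul] using this
    · rw [mul_zero]
      have hlt : R < ‖w‖ := lt_of_le_of_ne (not_lt.1 h) (Ne.symm hw)
      refine DiffContOnCl.circleIntegral_eq_zero hR.le (DifferentiableOn.diffContOnCl ?_)
      intro ζ hζ
      have hζ' : ‖ζ‖ ≤ R := by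
        simpa using closure_ball_subset_closedBall hζ
      refine ((hf ζ).div (by fun_prop) ?_).differentiableWithinAt
      intro h0
      rw [sub_eq_zero.1 h0] at hζ'
      linarith
  have hcoef : ∀ k : ℕ, iteratedDeriv k f 0 / (Nat.factorial k : ℂ) * w ^ k =
      (2 * Real.pi * Complex.I)⁻¹ * ∮ ζ in C(0, R), w ^ k * (f ζ / ζ ^ (k + 1)) := by
    intro k
    have h := (hf.differentiableOn (s := closedBall 0 R)).circleIntegral_one_div_sub_center_pow_smul
      hR k
    have h' : (∮ ζ in C(0, R), w ^ k * (f ζ / ζ ^ (k + 1))) =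
        w ^ k * ((2 * Real.pi * Complex.I / k.factorial) * iteratedDeriv k f 0) := by
      rw [← smul_eq_mul (_ / _), ← h, ← circleIntegral.integral_const_mul]
      congr 1
      ext ζ
      simp [div_eq_inv_mul]
    rw [h']
    field_simp
  unfold maclaurinSum
  simp only [hcoef]
  rw [← Finset.mul_sum, ← circleIntegral.integral_fun_sum]
  · have hsum : (∮ ζ in C(0, R), ∑ k ∈ Finset.range n, w ^ k * (f ζ / ζ ^ (k + 1))) =
        (∮ ζ in C(0, R), (f ζ / (ζ - w) - f ζ * w ^ n / (ζ ^ n * (ζ - w)))) := by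
      refine circleIntegral.integral_congr hR.le fun ζ hζ => ?_
      obtain ⟨h0, h1⟩ := hsph ζ hζ
      have hq : w / ζ ≠ 1 := by
        intro h
        rw [div_eq_one_iff_eq h0] at h
        exact h1 (by rw [h, sub_self])
      have hterm : ∀ k : ℕ, w ^ k * (f ζ / ζ ^ (k + 1)) = f ζ / ζ * (w / ζ) ^ k := by
        intro k
        rw [div_pow, pow_succ]
        field_simp
      simp only [hterm]
      rw [← Finset.mul_sum, geom_sum_eq hq]
      have h2 : w / ζ - 1 ≠ 0 := sub_ne_zero.2 hq
      have h3 : w - ζ ≠ 0 := by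
        intro h; exact h1 (by rw [← neg_sub, h, neg_zero])
      rw [div_pow]
      field_simp
      ring
    rw [hsum, circleIntegral.integral_sub, hcauchy]
    · rw [mul_sub, inv_mul_cancel_left₀ hpi]
    · refine hcont _ (ContinuousOn.div hf.continuous.continuousOn (by fun_prop) ?_)
      exact fun ζ hζ => (hsph ζ hζ).2
    · refine hcont _ (ContinuousOn.div
        (hf.continuous.mul continuous_const).continuousOn (by fun_prop) ?_)
      exact fun ζ hζ => mul_ne_zero (pow_ne_zero _ (hsph ζ hζ).1) (hsph ζ hζ).2
  · intro k _
    refine hcont _ (ContinuousOn.mul continuousOn_const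
      (ContinuousOn.div hf.continuous.continuousOn (by fun_prop) ?_))
    exact fun ζ hζ => pow_ne_zero _ (hsph ζ hζ).1

/-- A circle integral around the origin, parametrised by `ζ = r * exp ((η + i x) / S)`. -/
theorem circleIntegral_eq_intervalIntegral_exp (F : ℂ → ℂ) (r η : ℝ) {S : ℝ} (hS : 0 < S) :
    (∮ ζ in C(0, r * Real.exp (η / S)), F ζ) =
      (S : ℂ)⁻¹ * ∫ x in (-(Real.pi * S))..(Real.pi * S),
        Complex.I * ((r : ℂ) * Complex.exp ((η + x * Complex.I) / S)) *
          F ((r : ℂ) * Complex.exp ((η + x * Complex.I) / S)) := by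
  have hmap : ∀ x : ℝ, (r : ℂ) * Complex.exp ((η + x * Complex.I) / S) =
      circleMap 0 (r * Real.exp (η / S)) (x / S) := by
    intro x
    rw [circleMap, zero_add, add_div, Complex.exp_add]
    push_cast
    rw [mul_assoc]
    congr 3
    ring
  simp only [hmap]
  have h1 := intervalIntegral.inv_smul_integral_comp_div (a := -(Real.pi * S)) (b := Real.pi * S)
    (fun t : ℝ => Complex.I * circleMap 0 (r * Real.exp (η / S)) t *
      F (circleMap 0 (r * Real.exp (η / S)) t)) S
  rw [neg_div, mul_div_cancel_right₀ _ hS.ne'] at h1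
  rw [← Complex.ofReal_inv, ← Complex.real_smul, h1, circleIntegral]
  have hper : Function.Periodic (fun t : ℝ => Complex.I * circleMap 0 (r * Real.exp (η / S)) t *
      F (circleMap 0 (r * Real.exp (η / S)) t)) (2 * Real.pi) := by
    intro t
    simp only [periodic_circleMap 0 (r * Real.exp (η / S)) t]
  -- Shifting the period to `[-π, π]` puts the saddle `x = 0` in the middle and makes `x / S` the
  -- principal argument.
  have h2 := hper.intervalIntegral_add_eq (-Real.pi) 0
  rw [show -Real.pi + 2 * Real.pi = Real.pi by ring, zero_add] at h2
  rw [h2]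
  congr 1
  ext t
  simp only [deriv_circleMap, smul_eq_mul]
  ring

end PartialSums

/-! ### Rescaled integrand and Cauchy integral. -/

section SaddleData

/-- The point `exp ((η + i x) / √n)`; for fixed `η` these run through a circle about `0`. -/
noncomputable def circlePoint (η : ℝ) (n : ℕ) (x : ℝ) : ℂ :=
  Complex.exp ((η + x * Complex.I) / (Real.sqrt n : ℝ))

/-- The size `r_n^a (log r_n)^b exp (n / lam)` of the comparison function at `r_n`. -/
noncomputable def saddleScale (a b : ℂ) (lam : ℝ) (n : ℕ) : ℂ :=
  (scaleRadius lam n : ℂ) ^ a * Complex.log (scaleRadius lam n) ^ b *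
    Complex.exp ((n / lam : ℝ) : ℂ)

/-- The integrand `f (r_n s) / s^n` at `s = circlePoint η n x`, normalised by its size at `s = 1`. -/
noncomputable def saddleIntegrand (f : ℂ → ℂ) (a b : ℂ) (lam η : ℝ) (n : ℕ) (x : ℝ) : ℂ :=
  f (scaleRadius lam n * circlePoint η n x) / (saddleScale a b lam n * circlePoint η n x ^ n)

/-- The Cauchy-type integral of `saddleIntegrand` against `1 / (1 - z / s)`. -/
noncomputable def cauchySaddleIntegral (f : ℂ → ℂ) (a b : ℂ) (lam η : ℝ) (n : ℕ) (z : ℂ) : ℂ :=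
  (2 * Real.pi : ℂ)⁻¹ * ∫ x in (-(Real.pi * Real.sqrt n))..(Real.pi * Real.sqrt n),
    saddleIntegrand f a b lam η n x * ((Real.sqrt n : ℂ) * (1 - z / circlePoint η n x))⁻¹

theorem circlePoint_ne_zero (η : ℝ) (n : ℕ) (x : ℝ) : circlePoint η n x ≠ 0 :=
  Complex.exp_ne_zero _

theorem norm_circlePoint (η : ℝ) (n : ℕ) (x : ℝ) :
    ‖circlePoint η n x‖ = Real.exp (η / Real.sqrt n) := by
  rw [circlePoint, Complex.norm_exp]
  congr 1
  rw [Complex.div_ofReal_re]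
  simp

theorem scaleRadius_pos {lam : ℝ} (hlam : 0 < lam) {n : ℕ} (hn : 0 < n) :
    0 < scaleRadius lam n := by
  have : (0 : ℝ) < n := by exact_mod_cast hn
  exact Real.rpow_pos_of_pos (by positivity) _

/-- The scaled partial sum through `cauchySaddleIntegral`. -/
theorem maclaurinSum_scaled {f : ℂ → ℂ} (hf : Differentiable ℂ f) (a b : ℂ) {lam : ℝ}
    (hlam : 0 < lam) (η : ℝ) {n : ℕ} (hn : 0 < n) (hG : saddleScale a b lam n ≠ 0) {z : ℂ}
    (hz : ‖z‖ ≠ Real.exp (η / Real.sqrt n)) :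
    maclaurinSum f n (scaleRadius lam n * z) =
      (if ‖z‖ < Real.exp (η / Real.sqrt n) then f (scaleRadius lam n * z) else 0) -
        z ^ n * saddleScale a b lam n * cauchySaddleIntegral f a b lam η n z := by
  have hr := scaleRadius_pos hlam hn
  set r := scaleRadius lam n with hrdef
  have hS : 0 < Real.sqrt n := Real.sqrt_pos.2 (by exact_mod_cast hn)
  have hnorm : ‖(r : ℂ) * z‖ = r * ‖z‖ := by
    rw [norm_mul, Complex.norm_real, Real.norm_of_nonneg hr.le]
  rw [maclaurinSum_eq_sub_circleIntegral hf n (R := r * Real.exp (η / Real.sqrt n)) (by positivity)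
    (by rw [hnorm]; exact fun h => hz (mul_left_cancel₀ hr.ne' h)), hnorm]
  have hiff : r * ‖z‖ < r * Real.exp (η / Real.sqrt n) ↔ ‖z‖ < Real.exp (η / Real.sqrt n) :=
    mul_lt_mul_iff_right₀ hr
  simp only [hiff]
  congr 1
  rw [circleIntegral_eq_intervalIntegral_exp _ _ _ hS, cauchySaddleIntegral,
    ← intervalIntegral.integral_const_mul, ← intervalIntegral.integral_const_mul,
    ← intervalIntegral.integral_const_mul, ← intervalIntegral.integral_const_mul]
  refine intervalIntegral.integral_congr fun x _ => ?_
  have hs : circlePoint η n x ≠ 0 := circlePoint_ne_zero η n x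
  have hS' : (Real.sqrt n : ℂ) ≠ 0 := by exact_mod_cast hS.ne'
  have hr' : (r : ℂ) ≠ 0 := by exact_mod_cast hr.ne'
  have hsz : circlePoint η n x - z ≠ 0 := by
    intro h
    apply hz
    rw [← sub_eq_zero.1 h, norm_circlePoint]
  have hsz' : 1 - z / circlePoint η n x ≠ 0 := by
    rw [one_sub_div hs]; exact div_ne_zero hsz hs
  have hpi : (Real.pi : ℂ) ≠ 0 := by exact_mod_cast Real.pi_ne_zero
  rw [saddleIntegrand]
  change _ * (_ * (Complex.I * (r * circlePoint η n x) * (f (r * circlePoint η n x) * _ /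
    ((r * circlePoint η n x) ^ n * (r * circlePoint η n x - r * z))))) = _
  rw [← hrdef, ← mul_sub, one_sub_div hs]
  generalize circlePoint η n x = s at *
  have := Complex.I_ne_zero
  rw [mul_pow, mul_pow]
  field_simp

end SaddleData

/-! ### Asymptotics of `f (r_n z)` inside the sector. -/

section SectorAsymptotics

theorem ofReal_mul_cpow {r : ℝ} (hr : 0 < r) {z : ℂ} (hz : z ≠ 0) (c : ℂ) :
    ((r : ℂ) * z) ^ c = (r : ℂ) ^ c * z ^ c := by
  have hr' : (r : ℂ) ≠ 0 := by exact_mod_cast hr.ne'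
  rw [Complex.cpow_def_of_ne_zero (mul_ne_zero hr' hz), Complex.cpow_def_of_ne_zero hr',
    Complex.cpow_def_of_ne_zero hz, Complex.log_ofReal_mul hr hz, Complex.ofReal_log hr.le,
    add_mul, Complex.exp_add]

theorem scaleRadius_cpow {lam : ℝ} (hlam : 0 < lam) (n : ℕ) :
    (scaleRadius lam n : ℂ) ^ (lam : ℂ) = ((n / lam : ℝ) : ℂ) := by
  have h0 : (0 : ℝ) ≤ (n : ℝ) / lam := by positivity
  rw [scaleRadius, ← Complex.ofReal_cpow (Real.rpow_nonneg h0 _), ← Real.rpow_mul h0,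
    one_div_mul_cancel hlam.ne', Real.rpow_one]

theorem scaleRadius_rpow {lam : ℝ} (hlam : 0 < lam) (n : ℕ) :
    scaleRadius lam n ^ lam = n / lam := by
  have h0 : (0 : ℝ) ≤ (n : ℝ) / lam := by positivity
  rw [scaleRadius, ← Real.rpow_mul h0, one_div_mul_cancel hlam.ne', Real.rpow_one]

theorem tendsto_scaleRadius {lam : ℝ} (hlam : 0 < lam) :
    Tendsto (scaleRadius lam) atTop atTop :=
  (tendsto_rpow_atTop (by positivity)).comp
    (tendsto_natCast_atTop_atTop.atTop_div_const hlam)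

theorem saddleScale_ne_zero (a b : ℂ) {lam : ℝ} {n : ℕ} (hr : 1 < scaleRadius lam n) :
    saddleScale a b lam n ≠ 0 := by
  have h0 : (scaleRadius lam n : ℂ) ≠ 0 := by exact_mod_cast (one_pos.trans hr).ne'
  have h1 : Complex.log (scaleRadius lam n) ≠ 0 := by
    rw [← Complex.ofReal_log (one_pos.trans hr).le]
    exact_mod_cast (Real.log_pos hr).ne'
  refine mul_ne_zero (mul_ne_zero ?_ ?_) (Complex.exp_ne_zero _)
  · simp [Complex.cpow_eq_zero_iff, h0]
  · simp [Complex.cpow_eq_zero_iff, h1]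

/-- The comparison function at `r_n z`, relative to its value at `r_n`. -/
theorem comparison_scaled (a b : ℂ) {lam : ℝ} (hlam : 0 < lam) {n : ℕ}
    (hr : 1 < scaleRadius lam n) {z : ℂ} (hz : z ≠ 0)
    (hl : 1 + Complex.log z / Real.log (scaleRadius lam n) ≠ 0) :
    (scaleRadius lam n * z : ℂ) ^ a * Complex.log (scaleRadius lam n * z) ^ b *
        Complex.exp ((scaleRadius lam n * z : ℂ) ^ (lam : ℂ)) =
      saddleScale a b lam n * Complex.exp ((n / lam : ℝ) * (z ^ (lam : ℂ) - 1)) *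
        (z ^ a * (1 + Complex.log z / Real.log (scaleRadius lam n)) ^ b) := by
  have hr0 : 0 < scaleRadius lam n := one_pos.trans hr
  have hlr := Real.log_pos hr
  have hlr' : (Real.log (scaleRadius lam n) : ℂ) ≠ 0 := by exact_mod_cast hlr.ne'
  have hlog : Complex.log (scaleRadius lam n * z) = (Real.log (scaleRadius lam n) : ℂ) *
      (1 + Complex.log z / Real.log (scaleRadius lam n)) := by
    rw [Complex.log_ofReal_mul hr0 hz]
    field_simp
  rw [hlog, ofReal_mul_cpow hlr hl, ofReal_mul_cpow hr0 hz, ofReal_mul_cpow hr0 hz,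
    scaleRadius_cpow hlam, saddleScale, ← Complex.ofReal_log hr0.le, mul_sub, mul_one,
    Complex.exp_sub]
  field_simp

theorem tendsto_ofReal_mul_cobounded {ι : Type*} {l : Filter ι} {r : ι → ℝ} {z : ι → ℂ} {z₀ : ℂ}
    (hr : Tendsto r l atTop) (hz : Tendsto z l (𝓝 z₀)) (hz₀ : z₀ ≠ 0) :
    Tendsto (fun k => (r k : ℂ) * z k) l (cobounded ℂ) := by
  rw [← tendsto_norm_atTop_iff_cobounded]
  have h := hr.atTop_mul_pos (norm_pos_iff.2 hz₀) hz.norm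
  refine h.congr' ?_
  filter_upwards [hr.eventually_ge_atTop 0] with k hk
  rw [norm_mul, Complex.norm_real, Real.norm_of_nonneg hk]

theorem mem_slitPlane_of_abs_arg_lt {θ : ℝ} (hθπ : θ < Real.pi) {z₀ : ℂ} (hz₀ : z₀ ≠ 0)
    (harg : |Complex.arg z₀| < θ) : z₀ ∈ Complex.slitPlane := by
  rw [Complex.mem_slitPlane_iff_arg]
  refine ⟨fun h => ?_, hz₀⟩
  rw [h, abs_of_pos Real.pi_pos] at harg
  exact lt_asymm harg hθπ

/-- Asymptotics of `f (r_n z_k)` as `z_k` tends to a point of the open sector. -/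
theorem OneDirectionGrowth.tendsto_rescaled {a b : ℂ} {lam θ μ : ℝ} {f : ℂ → ℂ}
    (hf : OneDirectionGrowth a b lam θ μ f) (hlam : 0 < lam) (hθπ : θ < Real.pi)
    {ι : Type*} {l : Filter ι} {n : ι → ℕ} {z : ι → ℂ} {z₀ : ℂ} (hn : Tendsto n l atTop)
    (hz : Tendsto z l (𝓝 z₀)) (hz₀ : z₀ ≠ 0) (harg : |Complex.arg z₀| < θ) :
    Tendsto (fun k => f (scaleRadius lam (n k) * z k) / (saddleScale a b lam (n k) *
      Complex.exp ((n k / lam : ℝ) * (z k ^ (lam : ℂ) - 1)))) l (𝓝 (z₀ ^ a)) := by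
  have hslit := mem_slitPlane_of_abs_arg_lt hθπ hz₀ harg
  have hr := (tendsto_scaleRadius hlam).comp hn
  have hcob := tendsto_ofReal_mul_cobounded hr hz hz₀
  have hargev : ∀ᶠ k in l, |Complex.arg (z k)| < θ :=
    ((Complex.continuousAt_arg hslit).tendsto.comp hz).abs.eventually_lt_const harg
  have hsector : Tendsto (fun k => (scaleRadius lam (n k) : ℂ) * z k) l
      (cobounded ℂ ⊓ 𝓟 {z : ℂ | |Complex.arg z| ≤ θ}) := by
    rw [tendsto_inf, tendsto_principal]
    refine ⟨hcob, ?_⟩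
    filter_upwards [hargev, hr.eventually_gt_atTop 0] with k hk hk0
    have hk0' : 0 < scaleRadius lam (n k) := hk0
    rw [Complex.arg_real_mul _ hk0']
    exact hk.le
  have hlogr : Tendsto (fun k => Real.log (scaleRadius lam (n k))) l atTop :=
    Real.tendsto_log_atTop.comp hr
  -- Since `log (r_n z) = log r_n * (1 + log z / log r_n)`, the logarithmic factor contributes
  -- nothing to the limit: only `z₀ ^ a` survives.
  have hbase : Tendsto (fun k => 1 + Complex.log (z k) / Real.log (scaleRadius lam (n k))) l
      (𝓝 1) := by
    have h1 : Tendsto (fun k => ((Real.log (scaleRadius lam (n k)))⁻¹ : ℝ)) l (𝓝 0) :=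
      hlogr.inv_tendsto_atTop
    have h2 := (hz.clog hslit).mul ((Complex.continuous_ofReal.tendsto 0).comp h1)
    have h3 := h2.const_add 1
    simpa [div_eq_mul_inv] using h3
  have hfac : Tendsto (fun k => z k ^ a *
      (1 + Complex.log (z k) / Real.log (scaleRadius lam (n k))) ^ b) l (𝓝 (z₀ ^ a)) := by
    have h1 := (hz.cpow tendsto_const_nhds hslit : Tendsto (fun k => z k ^ a) l _)
    have h2 : Tendsto (fun k => (1 + Complex.log (z k) / Real.log (scaleRadius lam (n k))) ^ b) l
      (𝓝 ((1 : ℂ) ^ b)) := hbase.cpow tendsto_const_nhds Complex.one_mem_slitPlane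
    simpa using h1.mul h2
  have hbase0 := hbase.eventually_ne one_ne_zero
  have hz0 := hz.eventually_ne hz₀
  have hr1 := hr.eventually_gt_atTop 1
  have h1 := (hf.sector.comp_tendsto hsector)
  have hmodel : ∀ᶠ k in l, (scaleRadius lam (n k) * z k : ℂ) ^ a *
      Complex.log (scaleRadius lam (n k) * z k) ^ b *
        Complex.exp ((scaleRadius lam (n k) * z k : ℂ) ^ (lam : ℂ)) =
      saddleScale a b lam (n k) * Complex.exp ((n k / lam : ℝ) * (z k ^ (lam : ℂ) - 1)) *
        (z k ^ a * (1 + Complex.log (z k) / Real.log (scaleRadius lam (n k))) ^ b) := by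
    filter_upwards [hbase0, hz0, hr1] with k h1 h2 h3
    exact comparison_scaled a b hlam h3 h2 h1
  have hne : ∀ᶠ k in l, z k ^ a *
      (1 + Complex.log (z k) / Real.log (scaleRadius lam (n k))) ^ b ≠ 0 := by
    refine hfac.eventually_ne ?_
    simp [Complex.cpow_eq_zero_iff, hz₀]
  have hne' : ∀ᶠ k in l, saddleScale a b lam (n k) *
      Complex.exp ((n k / lam : ℝ) * (z k ^ (lam : ℂ) - 1)) ≠ 0 := by
    filter_upwards [hr1] with k hk
    exact mul_ne_zero (saddleScale_ne_zero a b hk) (Complex.exp_ne_zero _)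
  have h2 := (isEquivalent_iff_tendsto_one (by
    filter_upwards [hmodel, hne, hne'] with k h1 h2 h3
    simp only [Function.comp_apply]
    rw [h1]
    exact mul_ne_zero h3 h2)).1 h1
  have h3 := h2.mul hfac
  rw [one_mul] at h3
  refine h3.congr' ?_
  filter_upwards [hmodel, hne, hne'] with k h1 h2 h3
  simp only [Pi.div_apply, Function.comp_apply]
  rw [h1, div_mul_eq_mul_div, mul_div_mul_right _ _ h2]

end SectorAsymptotics

/-! ### Pointwise Gaussian limit at the saddle. -/

section SaddlePointwise

theorem tendsto_sqrt_natCast : Tendsto (fun n : ℕ => Real.sqrt n) atTop atTop :=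
  Real.tendsto_sqrt_atTop.comp tendsto_natCast_atTop_atTop

theorem tendsto_div_sqrt_natCast (u : ℂ) :
    Tendsto (fun n : ℕ => u / (Real.sqrt n : ℂ)) atTop (𝓝 0) := by
  have h1 := (Complex.continuous_ofReal.tendsto 0).comp tendsto_sqrt_natCast.inv_tendsto_atTop
  simpa [div_eq_mul_inv] using h1.const_mul u

theorem tendsto_circlePoint (η x : ℝ) : Tendsto (fun n => circlePoint η n x) atTop (𝓝 1) := by
  have := (Complex.continuous_exp.tendsto 0).comp (tendsto_div_sqrt_natCast (η + x * Complex.I))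
  simpa [circlePoint, Function.comp_def] using this

theorem log_circlePoint {η x : ℝ} {n : ℕ} (h : |x / Real.sqrt n| < Real.pi) :
    Complex.log (circlePoint η n x) = (η + x * Complex.I) / (Real.sqrt n : ℂ) := by
  have him : ((η + x * Complex.I) / (Real.sqrt n : ℂ)).im = x / Real.sqrt n := by
    rw [Complex.div_ofReal_im]
    simp
  rw [circlePoint, Complex.log_exp]
  · rw [him]; exact (abs_lt.1 h).1
  · rw [him]; exact (abs_lt.1 h).2.le

theorem arg_circlePoint {η x : ℝ} {n : ℕ} (h : |x / Real.sqrt n| < Real.pi) :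
    Complex.arg (circlePoint η n x) = x / Real.sqrt n := by
  rw [← Complex.log_im, log_circlePoint h, Complex.div_ofReal_im]
  simp

theorem circlePoint_cpow {η x : ℝ} {n : ℕ} (h : |x / Real.sqrt n| < Real.pi) (lam : ℂ) :
    circlePoint η n x ^ lam = Complex.exp (lam * ((η + x * Complex.I) / (Real.sqrt n : ℂ))) := by
  rw [Complex.cpow_def_of_ne_zero (circlePoint_ne_zero η n x), log_circlePoint h, mul_comm]

theorem circlePoint_pow {η x : ℝ} {n : ℕ} :
    circlePoint η n x ^ n = Complex.exp (n * ((η + x * Complex.I) / (Real.sqrt n : ℂ))) := by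
  rw [circlePoint, ← Complex.exp_nat_mul]

/-- `(n / lam) (e^w - 1 - w)` with `w = lam u / √n` tends to `lam u² / 2`. -/
theorem tendsto_saddle_exponent {lam : ℝ} (hlam : 0 < lam) (u : ℂ) :
    Tendsto (fun n : ℕ => ((n / lam : ℝ) : ℂ) *
      (Complex.exp (lam * (u / (Real.sqrt n : ℂ))) - 1 - lam * (u / (Real.sqrt n : ℂ))))
      atTop (𝓝 (lam * u ^ 2 / 2)) := by
  have hw : Tendsto (fun n : ℕ => (lam : ℂ) * (u / (Real.sqrt n : ℂ))) atTop (𝓝 0) := by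
    simpa using (tendsto_div_sqrt_natCast u).const_mul (lam : ℂ)
  have ho := (Complex.exp_sub_sum_range_succ_isLittleO_pow 2).comp_tendsto hw
  have hsq : ∀ n : ℕ, 0 < n → ((n / lam : ℝ) : ℂ) * ((lam : ℂ) * (u / (Real.sqrt n : ℂ))) ^ 2 =
      lam * u ^ 2 := by
    intro n hn
    have hn' : (n : ℂ) ≠ 0 := by exact_mod_cast hn.ne'
    have hl : (lam : ℂ) ≠ 0 := by exact_mod_cast hlam.ne'
    have hs : (Real.sqrt n : ℂ) ^ 2 = n := by
      rw [← Complex.ofReal_pow, Real.sq_sqrt (Nat.cast_nonneg n)]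
      simp
    rw [mul_pow, div_pow, hs]
    push_cast
    field_simp
  -- The Taylor remainder is `o(w²)`, while `(n / lam) w²` is the constant `lam u²` by `hsq`, so the
  -- remainder vanishes in the limit.
  have h1 := (isBigO_refl (fun n : ℕ => ((n / lam : ℝ) : ℂ)) atTop).mul_isLittleO ho
  have h2 : Tendsto (fun n : ℕ => ((n / lam : ℝ) : ℂ) *
      (Complex.exp ((lam : ℂ) * (u / (Real.sqrt n : ℂ))) -
        ∑ i ∈ Finset.range (2 + 1), ((lam : ℂ) * (u / (Real.sqrt n : ℂ))) ^ i / (i.factorial : ℂ)))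
        atTop (𝓝 0) := by
    rw [← isLittleO_one_iff ℂ]
    refine h1.trans_isBigO ?_
    refine IsBigO.of_bound ‖(lam : ℂ) * u ^ 2‖ ?_
    filter_upwards [eventually_gt_atTop 0] with n hn
    simp only [Function.comp_apply]
    rw [hsq n hn]
    simp
  have h3 := h2.add_const ((lam : ℂ) * u ^ 2 / 2)
  rw [zero_add] at h3
  refine h3.congr' ?_
  filter_upwards [eventually_gt_atTop 0] with n hn
  rw [← hsq n hn]
  simp [Finset.sum_range_succ]
  ring

/-- Pointwise limit of the normalised integrand near the saddle point. -/
theorem OneDirectionGrowth.tendsto_saddleIntegrand {a b : ℂ} {lam θ μ : ℝ} {f : ℂ → ℂ}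
    (hf : OneDirectionGrowth a b lam θ μ f) (hlam : 0 < lam) (hθ : 0 < θ) (hθπ : θ < Real.pi)
    (η x : ℝ) :
    Tendsto (fun n => saddleIntegrand f a b lam η n x) atTop
      (𝓝 (Complex.exp (lam * (η + x * Complex.I) ^ 2 / 2))) := by
  have h1 := hf.tendsto_rescaled hlam hθπ (n := fun n => n) tendsto_id (tendsto_circlePoint η x)
    one_ne_zero (by simpa using hθ)
  have h2 := h1.mul ((Complex.continuous_exp.tendsto _).comp
    (tendsto_saddle_exponent hlam (η + x * Complex.I)))
  rw [Complex.one_cpow, one_mul] at h2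
  refine h2.congr' ?_
  have hx : Tendsto (fun n : ℕ => |x / Real.sqrt n|) atTop (𝓝 0) := by
    simpa using (tendsto_sqrt_natCast.const_div_atTop x).abs
  filter_upwards [hx.eventually_lt_const Real.pi_pos,
    (tendsto_scaleRadius hlam).eventually_gt_atTop 1] with n hn hr
  have hG := saddleScale_ne_zero a b hr
  have hl : (lam : ℂ) ≠ 0 := by exact_mod_cast hlam.ne'
  rw [saddleIntegrand, circlePoint_cpow hn, circlePoint_pow, Function.comp_apply, mul_sub _ (_ - _),
    Complex.exp_sub]
  have he : ((n / lam : ℝ) : ℂ) * (lam * ((η + x * Complex.I) / (Real.sqrt n : ℂ))) =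
      n * ((η + x * Complex.I) / (Real.sqrt n : ℂ)) := by
    push_cast
    field_simp
  rw [he]
  have e1 := Complex.exp_ne_zero (n * ((η + x * Complex.I) / (Real.sqrt n : ℂ)))
  have e2 := Complex.exp_ne_zero (((n / lam : ℝ) : ℂ) *
    (Complex.exp (lam * ((η + x * Complex.I) / (Real.sqrt n : ℂ))) - 1))
  generalize Complex.exp (n * ((η + x * Complex.I) / (Real.sqrt n : ℂ))) = A at *
  generalize Complex.exp (((n / lam : ℝ) : ℂ) *
    (Complex.exp (lam * ((η + x * Complex.I) / (Real.sqrt n : ℂ))) - 1)) = B at *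
  field_simp

end SaddlePointwise

/-! ### Uniform Gaussian majorant. -/

section GaussianDomination

/-- Write `1 - cos v = 2 sin² (|v| / 2)` and bound the concave sine below by its chord on `[0, V /
2]`. The chord has positive slope exactly because `V / 2 < π`; with `V = lam θ` this is where `lam θ
< 2π` enters. -/
theorem exists_quadratic_le_one_sub_cos {V : ℝ} (hV : 0 < V) (hV' : V < 2 * Real.pi) :
    ∃ c > 0, ∀ v : ℝ, |v| ≤ V → c * v ^ 2 ≤ 1 - Real.cos v := by
  have hs : 0 < Real.sin (V / 2) := Real.sin_pos_of_pos_of_lt_pi (by linarith) (by linarith)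
  refine ⟨2 * (Real.sin (V / 2) / V) ^ 2, by positivity, fun v hv => ?_⟩
  have hcos : 1 - Real.cos v = 2 * Real.sin (|v| / 2) ^ 2 := by
    rw [← Real.cos_abs v]
    have := Real.cos_two_mul (|v| / 2)
    rw [mul_div_cancel₀ _ two_ne_zero] at this
    have h2 := Real.sin_sq_add_cos_sq (|v| / 2)
    linarith
  have hconc := strictConcaveOn_sin_Icc.concaveOn.2
    (show (0 : ℝ) ∈ Set.Icc 0 Real.pi from ⟨le_rfl, Real.pi_pos.le⟩)
    (show V / 2 ∈ Set.Icc 0 Real.pi from ⟨by linarith, by linarith⟩)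
    (show 0 ≤ 1 - |v| / V by rw [sub_nonneg, div_le_one hV]; exact hv)
    (show 0 ≤ |v| / V by positivity) (by ring)
  simp only [smul_eq_mul, mul_zero, zero_add, Real.sin_zero] at hconc
  have he : |v| / V * (V / 2) = |v| / 2 := by field_simp
  rw [he] at hconc
  rw [hcos, ← sq_abs v, mul_assoc, ← mul_pow]
  have h0 : 0 ≤ Real.sin (V / 2) / V * |v| := by positivity
  have h1 : Real.sin (V / 2) / V * |v| ≤ Real.sin (|v| / 2) := by
    calc Real.sin (V / 2) / V * |v| = |v| / V * Real.sin (V / 2) := by ring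
      _ ≤ _ := hconc
  have := pow_le_pow_left₀ h0 h1 2
  linarith

theorem norm_cpow_le_exp {z : ℂ} (hz : z ≠ 0) (a : ℂ) :
    ‖z ^ a‖ ≤ Real.exp (‖Complex.log z‖ * ‖a‖) := by
  rw [Complex.cpow_def_of_ne_zero hz, Complex.norm_exp]
  refine Real.exp_le_exp.2 ((Complex.re_le_norm _).trans ?_)
  rw [norm_mul]

theorem norm_log_le_of_norm_mem {z : ℂ} (h1 : 1 / 2 ≤ ‖z‖) (h2 : ‖z‖ ≤ 2) :
    ‖Complex.log z‖ ≤ 5 := by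
  refine (Complex.norm_le_abs_re_add_abs_im _).trans ?_
  rw [Complex.log_re, Complex.log_im]
  have hpos : 0 < ‖z‖ := by linarith
  have hl : |Real.log ‖z‖| ≤ 1 := by
    rw [abs_le]
    constructor
    · have := Real.one_sub_inv_le_log_of_pos hpos
      have h3 : ‖z‖⁻¹ ≤ 2 := by
        rw [inv_le_comm₀ hpos two_pos]; linarith
      linarith
    · have := Real.log_le_sub_one_of_pos hpos
      linarith
  have := Complex.abs_arg_le_pi z
  have := Real.pi_le_four
  linarith

theorem OneDirectionGrowth.exists_norm_le_sector {a b : ℂ} {lam θ μ : ℝ} {f : ℂ → ℂ}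
    (hf : OneDirectionGrowth a b lam θ μ f) (hlam : 0 < lam) :
    ∃ C > 0, ∀ᶠ n : ℕ in atTop, ∀ z : ℂ, |Complex.arg z| ≤ θ → 1 / 2 ≤ ‖z‖ → ‖z‖ ≤ 2 →
      ‖f (scaleRadius lam n * z)‖ ≤ C * ‖saddleScale a b lam n‖ *
        Real.exp (n / lam * ((z ^ (lam : ℂ)).re - 1)) := by
  obtain ⟨C₀, hC₀, hbound⟩ := hf.sector.isBigO.exists_pos
  rw [isBigOWith_iff, eventually_inf_principal, hasBasis_cobounded_norm.eventually_iff] at hbound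
  obtain ⟨R, -, hR⟩ := hbound
  refine ⟨C₀ * (Real.exp (5 * ‖a‖) * Real.exp (1 * ‖b‖)), by positivity, ?_⟩
  have hr := tendsto_scaleRadius hlam
  -- `2 * R` compensates for `‖z‖ ≥ 1/2`. The threshold `10` is twice the bound `5` on `‖log z‖`, so
  -- that `1 + log z / log r_n` stays away from `0` and its logarithm has norm at most `1`.
  filter_upwards [hr.eventually_gt_atTop 1, hr.eventually_ge_atTop (2 * R),
    (Real.tendsto_log_atTop.comp hr).eventually_ge_atTop 10] with n hr1 hrR hlog z harg hz1 hz2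
  have hr0 : 0 < scaleRadius lam n := one_pos.trans hr1
  have hlog' : 10 ≤ Real.log (scaleRadius lam n) := hlog
  have hz : z ≠ 0 := by
    intro h; rw [h, norm_zero] at hz1; norm_num at hz1
  have hnorm : ‖(scaleRadius lam n : ℂ) * z‖ = scaleRadius lam n * ‖z‖ := by
    rw [norm_mul, Complex.norm_real, Real.norm_of_nonneg hr0.le]
  have hsmall : ‖Complex.log z / Real.log (scaleRadius lam n)‖ ≤ 1 / 2 := by
    rw [norm_div, Complex.norm_real, Real.norm_of_nonneg (by linarith),
      div_le_iff₀ (by linarith)]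
    linarith [norm_log_le_of_norm_mem hz1 hz2]
  have hl : 1 + Complex.log z / Real.log (scaleRadius lam n) ≠ 0 := by
    intro h
    have : ‖Complex.log z / Real.log (scaleRadius lam n)‖ = 1 := by
      rw [eq_neg_of_add_eq_zero_right h]; simp
    rw [this] at hsmall
    norm_num at hsmall
  have h1 := hR (x := (scaleRadius lam n : ℂ) * z)
    (by change R ≤ ‖(scaleRadius lam n : ℂ) * z‖; rw [hnorm]; nlinarith)
    (by change |Complex.arg _| ≤ θ; rw [Complex.arg_real_mul _ hr0]; exact harg)
  rw [comparison_scaled a b hlam hr1 hz hl] at h1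
  refine h1.trans ?_
  rw [norm_mul, norm_mul, norm_mul, Complex.norm_exp, Complex.re_ofReal_mul]
  have h2 : ‖z ^ a‖ ≤ Real.exp (5 * ‖a‖) :=
    (norm_cpow_le_exp hz a).trans (Real.exp_le_exp.2
      (mul_le_mul_of_nonneg_right (norm_log_le_of_norm_mem hz1 hz2) (norm_nonneg _)))
  have h3 : ‖(1 + Complex.log z / Real.log (scaleRadius lam n)) ^ b‖ ≤ Real.exp (1 * ‖b‖) := by
    refine (norm_cpow_le_exp hl b).trans (Real.exp_le_exp.2
      (mul_le_mul_of_nonneg_right ?_ (norm_nonneg _)))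
    have := Complex.norm_log_one_add_half_le_self hsmall
    linarith
  have h4 : ‖z ^ a‖ * ‖(1 + Complex.log z / Real.log (scaleRadius lam n)) ^ b‖ ≤
      Real.exp (5 * ‖a‖) * Real.exp (1 * ‖b‖) := by gcongr
  calc C₀ * (‖saddleScale a b lam n‖ * Real.exp (n / lam * ((z ^ (lam : ℂ) - 1).re)) *
        (‖z ^ a‖ * ‖(1 + Complex.log z / Real.log (scaleRadius lam n)) ^ b‖))
      ≤ C₀ * (‖saddleScale a b lam n‖ * Real.exp (n / lam * ((z ^ (lam : ℂ) - 1).re)) *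
        (Real.exp (5 * ‖a‖) * Real.exp (1 * ‖b‖))) := by gcongr
    _ = _ := by rw [Complex.sub_re, Complex.one_re]; ring

theorem OneDirectionGrowth.exists_norm_le_outside {a b : ℂ} {lam θ μ : ℝ} {f : ℂ → ℂ}
    (hf : OneDirectionGrowth a b lam θ μ f) (hlam : 0 < lam) :
    ∃ C > 0, ∀ᶠ n : ℕ in atTop, ∀ z : ℂ, θ < |Complex.arg z| → 1 / 2 ≤ ‖z‖ →
      ‖f (scaleRadius lam n * z)‖ ≤ C * Real.exp (μ * (n / lam * ‖z‖ ^ lam)) := by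
  obtain ⟨C₀, hC₀, hbound⟩ := hf.outside.exists_pos
  rw [isBigOWith_iff, eventually_inf_principal, hasBasis_cobounded_norm.eventually_iff] at hbound
  obtain ⟨R, -, hR⟩ := hbound
  refine ⟨C₀, hC₀, ?_⟩
  have hr := tendsto_scaleRadius hlam
  filter_upwards [hr.eventually_gt_atTop 0, hr.eventually_ge_atTop (2 * R)]
    with n hr0 hrR z harg hz1
  have hnorm : ‖(scaleRadius lam n : ℂ) * z‖ = scaleRadius lam n * ‖z‖ := by
    rw [norm_mul, Complex.norm_real, Real.norm_of_nonneg hr0.le]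
  have h1 := hR (x := (scaleRadius lam n : ℂ) * z)
    (by change R ≤ ‖(scaleRadius lam n : ℂ) * z‖; rw [hnorm]; nlinarith)
    (by change θ < |Complex.arg _|; rw [Complex.arg_real_mul _ hr0]; exact harg)
  rw [hnorm, Real.mul_rpow hr0.le (norm_nonneg _), scaleRadius_rpow hlam,
    Real.norm_of_nonneg (Real.exp_pos _).le] at h1
  exact h1

/-- The factors `r_n ^ a` and `(log r_n) ^ b` cost at most a power of `n`, hence less than `exp (δ
n)`. This allows the bound outside the sector to be compared with the normalisation. -/
theorem eventually_exp_le_norm_saddleScale (a b : ℂ) {lam : ℝ} (hlam : 0 < lam) {δ : ℝ}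
    (hδ : 0 < δ) :
    ∀ᶠ n : ℕ in atTop, Real.exp (n / lam - δ * n) ≤ ‖saddleScale a b lam n‖ := by
  have hr := tendsto_scaleRadius hlam
  -- As `1 ≤ log r_n ≤ r_n`, each of the two factors has norm at least `r_n` to minus the absolute
  -- real part of its exponent.
  set K := |a.re| + |b.re| with hK
  have hdiv : Tendsto (fun n : ℕ => (n : ℝ) / lam) atTop atTop :=
    tendsto_natCast_atTop_atTop.atTop_div_const hlam
  have ho := ((isLittleO_rpow_exp_pos_mul_atTop (K / lam) (mul_pos hδ hlam)).comp_tendsto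
    hdiv).bound one_pos
  filter_upwards [hr.eventually_gt_atTop 1,
    (Real.tendsto_log_atTop.comp hr).eventually_ge_atTop 1, ho] with n hr1 hlog hn
  have hlog' : 1 ≤ Real.log (scaleRadius lam n) := hlog
  have hr0 : 0 < scaleRadius lam n := one_pos.trans hr1
  have hn0 : (0 : ℝ) ≤ n / lam := by positivity
  have hrK : scaleRadius lam n ^ K ≤ Real.exp (δ * n) := by
    have h1 : scaleRadius lam n ^ K = ((n : ℝ) / lam) ^ (K / lam) := by
      rw [scaleRadius, ← Real.rpow_mul hn0]
      congr 1
      ring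
    simp only [Function.comp_apply, one_mul] at hn
    rw [Real.norm_of_nonneg (Real.rpow_nonneg hn0 _), Real.norm_of_nonneg (Real.exp_pos _).le] at hn
    rw [h1]
    refine hn.trans (le_of_eq ?_)
    congr 1
    field_simp
  have ha : scaleRadius lam n ^ (-|a.re|) ≤ ‖(scaleRadius lam n : ℂ) ^ a‖ := by
    rw [Complex.norm_cpow_eq_rpow_re_of_pos hr0]
    exact Real.rpow_le_rpow_of_exponent_le hr1.le (neg_abs_le _)
  have hb : scaleRadius lam n ^ (-|b.re|) ≤ ‖Complex.log (scaleRadius lam n) ^ b‖ := by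
    rw [← Complex.ofReal_log hr0.le, Complex.norm_cpow_eq_rpow_re_of_pos (by linarith)]
    calc scaleRadius lam n ^ (-|b.re|) ≤ Real.log (scaleRadius lam n) ^ (-|b.re|) :=
          Real.rpow_le_rpow_of_nonpos (by linarith)
            (by linarith [Real.log_le_sub_one_of_pos hr0]) (by simp)
      _ ≤ _ := Real.rpow_le_rpow_of_exponent_le hlog' (neg_abs_le _)
  rw [saddleScale, norm_mul, norm_mul, Complex.norm_exp, Complex.ofReal_re]
  calc Real.exp (n / lam - δ * n) = (Real.exp (δ * n))⁻¹ * Real.exp (n / lam) := by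
        rw [Real.exp_sub]; field_simp
    _ ≤ (scaleRadius lam n ^ K)⁻¹ * Real.exp (n / lam) := by
        gcongr
    _ = scaleRadius lam n ^ (-|a.re|) * scaleRadius lam n ^ (-|b.re|) * Real.exp (n / lam) := by
        rw [← Real.rpow_add hr0, ← Real.rpow_neg hr0.le, hK, neg_add]
    _ ≤ _ := by gcongr

/-- The normalised integrand is dominated by a Gaussian, uniformly in `n`. -/
theorem OneDirectionGrowth.exists_norm_saddleIntegrand_le {a b : ℂ} {lam θ μ : ℝ} {f : ℂ → ℂ}
    (hf : OneDirectionGrowth a b lam θ μ f) (hlam : 0 < lam) (hθ : 0 < θ) (hμ : μ < 1)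
    (hdir : lam * θ < 2 * Real.pi) (η : ℝ) :
    ∃ C > 0, ∃ c > 0, ∀ᶠ n : ℕ in atTop, ∀ x : ℝ, |x| < Real.pi * Real.sqrt n →
      ‖saddleIntegrand f a b lam η n x‖ ≤ C * Real.exp (-c * x ^ 2) := by
  obtain ⟨C₁, hC₁, hsec⟩ := hf.exists_norm_le_sector hlam
  obtain ⟨C₂, hC₂, hout⟩ := hf.exists_norm_le_outside hlam
  obtain ⟨c₀, hc₀, hcos⟩ := exists_quadratic_le_one_sub_cos (mul_pos hlam hθ) hdir
  -- The midpoint between `μ` and `1` absorbs the factor `exp (lam η / √n) → 1`. By the choice of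
  -- `δ` below, `m n / lam = n / lam - 4 δ n`: one `δ n` pays for the powers in `saddleScale`, one
  -- for `|s ^ n| = exp (√n η)`, and two for the Gaussian, since `x² ≤ π² n`.
  set m := (1 + μ) / 2 with hm
  have hm1 : 0 < 1 - m := by rw [hm]; linarith
  set δ := (1 - m) / (4 * lam) with hδ
  have hδ0 : 0 < δ := by positivity
  -- The `1/2` is the lower bound for `exp (lam η / √n)` multiplying `1 - cos`.
  set c₁ := lam * c₀ / 2 with hc₁
  set c₂ := 2 * δ / Real.pi ^ 2 with hc₂
  have hc₁0 : 0 < c₁ := by positivity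
  have hc₂0 : 0 < c₂ := by positivity
  refine ⟨C₁ * Real.exp (lam * η ^ 2) + C₂, by positivity, min c₁ c₂, lt_min hc₁0 hc₂0, ?_⟩
  have hy : Tendsto (fun n : ℕ => lam * η / Real.sqrt n) atTop (𝓝 0) :=
    tendsto_sqrt_natCast.const_div_atTop _
  have hη : Tendsto (fun n : ℕ => η / Real.sqrt n) atTop (𝓝 0) :=
    tendsto_sqrt_natCast.const_div_atTop _
  have hexpη : Tendsto (fun n : ℕ => Real.exp (η / Real.sqrt n)) atTop (𝓝 1) := by
    simpa [Function.comp_def] using (Real.continuous_exp.tendsto 0).comp hη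
  have hexpy : Tendsto (fun n : ℕ => Real.exp (lam * η / Real.sqrt n)) atTop (𝓝 1) := by
    simpa [Function.comp_def] using (Real.continuous_exp.tendsto 0).comp hy
  have hμy : Tendsto (fun n : ℕ => μ * Real.exp (lam * η / Real.sqrt n)) atTop (𝓝 μ) := by
    simpa using hexpy.const_mul μ
  filter_upwards [hsec, hout, eventually_exp_le_norm_saddleScale a b hlam hδ0,
    (tendsto_scaleRadius hlam).eventually_gt_atTop 1, eventually_gt_atTop 0,
    hexpη.eventually_const_le (show (1 / 2 : ℝ) < 1 by norm_num),
    hexpη.eventually_le_const (show (1 : ℝ) < 2 by norm_num),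
    hexpy.eventually_const_le (show (1 / 2 : ℝ) < 1 by norm_num),
    hy.abs.eventually_le_const (show |(0 : ℝ)| < 1 by norm_num),
    hη.abs.eventually_le_const (show |(0 : ℝ)| < δ by simpa using hδ0),
    hμy.eventually_le_const (show μ < m by rw [hm]; linarith)]
    with n hsec hout hG hr1 hn hs1 hs2 hy2 hy1 hηδ hμm x hx
  have hnpos : (0 : ℝ) < n := by exact_mod_cast hn
  have hS : 0 < Real.sqrt n := Real.sqrt_pos.2 hnpos
  have hSS : Real.sqrt n * Real.sqrt n = n := Real.mul_self_sqrt hnpos.le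
  set S := Real.sqrt n with hSdef
  have hxpi : |x / S| < Real.pi := by
    rw [abs_div, abs_of_pos hS, div_lt_iff₀ hS]; exact hx
  have hG0 : 0 < ‖saddleScale a b lam n‖ := norm_pos_iff.2 (saddleScale_ne_zero a b hr1)
  have hpow : ‖circlePoint η n x ^ n‖ = Real.exp (S * η) := by
    rw [norm_pow, norm_circlePoint, ← Real.exp_nat_mul, ← hSdef, ← hSS]
    congr 1
    field_simp
  have hnormH : ‖saddleIntegrand f a b lam η n x‖ =
      ‖f (scaleRadius lam n * circlePoint η n x)‖ /
        (‖saddleScale a b lam n‖ * Real.exp (S * η)) := by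
    rw [saddleIntegrand, norm_div, norm_mul, hpow]
  rw [hnormH, div_le_iff₀ (by positivity)]
  by_cases hxθ : |x / S| ≤ θ
  · have hf1 := hsec (circlePoint η n x) (by rwa [arg_circlePoint hxpi])
      (by rw [norm_circlePoint]; exact hs1) (by rw [norm_circlePoint]; exact hs2)
    refine hf1.trans ?_
    have hre : (circlePoint η n x ^ (lam : ℂ)).re =
        Real.exp (lam * η / S) * Real.cos (lam * (x / S)) := by
      rw [circlePoint_cpow hxpi, Complex.exp_re, Complex.re_ofReal_mul, Complex.im_ofReal_mul,
        Complex.div_ofReal_re, Complex.div_ofReal_im]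
      simp [← hSdef, mul_div_assoc]
    have hcx := hcos (lam * (x / S)) (by
      rw [abs_mul, abs_of_pos hlam]; exact mul_le_mul_of_nonneg_left hxθ hlam.le)
    -- In `e^y ≤ 1 + y + y²` with `y = lam η / S`, the linear term times `n / lam` is `S η`, which
    -- cancels the size of `s ^ n`. The quadratic term gives the constant `lam η²`.
    have hquad := (abs_le.1 (Real.abs_exp_sub_one_sub_id_le hy1)).2
    have hmain : (n : ℝ) / lam * ((circlePoint η n x ^ (lam : ℂ)).re - 1) ≤
        lam * η ^ 2 + -c₁ * x ^ 2 + S * η := by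
      rw [hre]
      have h1 : Real.exp (lam * η / S) * Real.cos (lam * (x / S)) - 1 ≤
          (lam * η / S) ^ 2 + lam * η / S - c₀ * (lam * (x / S)) ^ 2 / 2 := by
        have h2 : c₀ * (lam * (x / S)) ^ 2 / 2 ≤
            Real.exp (lam * η / S) * (1 - Real.cos (lam * (x / S))) := by
          have h3 : 0 ≤ c₀ * (lam * (x / S)) ^ 2 := by positivity
          nlinarith
        linarith
      refine (mul_le_mul_of_nonneg_left h1 (by positivity)).trans (le_of_eq ?_)
      rw [← hSS, hc₁]
      field_simp
      ring
    have hx2 : 0 ≤ x ^ 2 := sq_nonneg x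
    have hmin : -c₁ * x ^ 2 ≤ -(min c₁ c₂) * x ^ 2 := by
      have h1 := mul_le_mul_of_nonneg_right (min_le_left c₁ c₂) hx2
      linarith
    calc C₁ * ‖saddleScale a b lam n‖ *
          Real.exp (n / lam * ((circlePoint η n x ^ (lam : ℂ)).re - 1))
        ≤ C₁ * ‖saddleScale a b lam n‖ *
          Real.exp (lam * η ^ 2 + -(min c₁ c₂) * x ^ 2 + S * η) := by
          gcongr
          linarith
      _ = (C₁ * Real.exp (lam * η ^ 2)) * Real.exp (-(min c₁ c₂) * x ^ 2) *
          (‖saddleScale a b lam n‖ * Real.exp (S * η)) := by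
          rw [Real.exp_add, Real.exp_add]; ring
      _ ≤ _ := by gcongr; linarith
  · have hf1 := hout (circlePoint η n x) (by rw [arg_circlePoint hxpi]; exact not_le.1 hxθ)
      (by rw [norm_circlePoint]; exact hs1)
    refine hf1.trans ?_
    have hrpow : ‖circlePoint η n x‖ ^ lam = Real.exp (lam * η / S) := by
      rw [norm_circlePoint, ← Real.exp_mul, ← hSdef]
      congr 1
      ring
    have hxn : x ^ 2 ≤ Real.pi ^ 2 * n := by
      rw [← hSS, ← sq_abs x]
      exact (pow_le_pow_left₀ (abs_nonneg x) hx.le 2).trans (le_of_eq (by ring))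
    have hc₂x : c₂ * x ^ 2 ≤ 2 * δ * n := by
      rw [hc₂, div_mul_eq_mul_div, div_le_iff₀ (by positivity)]
      calc 2 * δ * x ^ 2 ≤ 2 * δ * (Real.pi ^ 2 * n) := by gcongr
        _ = _ := by ring
    have hmin : -(2 * δ * n) ≤ -(min c₁ c₂) * x ^ 2 := by
      have h1 := mul_le_mul_of_nonneg_right (min_le_right c₁ c₂) (sq_nonneg x)
      linarith
    have hSη : -(δ * n) ≤ S * η := by
      have h1 := (abs_le.1 hηδ).1
      rw [le_div_iff₀ hS] at h1
      rw [← hSS]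
      have h2 := mul_le_mul_of_nonneg_left h1 hS.le
      linarith
    have hδm : m * (n / lam) = n / lam - 4 * δ * n := by
      rw [hδ]; field_simp; ring
    have hexp : μ * (n / lam * Real.exp (lam * η / S)) ≤
        -(min c₁ c₂) * x ^ 2 + (n / lam - δ * n) + S * η := by
      have h1 : μ * (n / lam * Real.exp (lam * η / S)) ≤ m * (n / lam) := by
        have h2 : (0 : ℝ) ≤ n / lam := by positivity
        calc _ = μ * Real.exp (lam * η / S) * (n / lam) := by ring
          _ ≤ _ := mul_le_mul_of_nonneg_right hμm h2
      linarith
    rw [hrpow]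
    calc C₂ * Real.exp (μ * (n / lam * Real.exp (lam * η / S)))
        ≤ C₂ * Real.exp (-(min c₁ c₂) * x ^ 2 + (n / lam - δ * n) + S * η) := by gcongr
      _ = C₂ * Real.exp (-(min c₁ c₂) * x ^ 2) *
          (Real.exp (n / lam - δ * n) * Real.exp (S * η)) := by
          rw [Real.exp_add, Real.exp_add]; ring
      _ ≤ C₂ * Real.exp (-(min c₁ c₂) * x ^ 2) *
          (‖saddleScale a b lam n‖ * Real.exp (S * η)) := by gcongr
      _ ≤ _ := by
          gcongr
          have : 0 < C₁ * Real.exp (lam * η ^ 2) := by positivity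
          linarith

end GaussianDomination

/-! ### Limits of integrals and nonvanishing of the Gaussian limits. -/

section DominatedLimits

open MeasureTheory

theorem integrable_one_add_abs_mul_exp_neg_mul_sq {c : ℝ} (hc : 0 < c) :
    Integrable fun x : ℝ => (1 + |x|) * Real.exp (-c * x ^ 2) := by
  have h1 := integrable_exp_neg_mul_sq hc
  have h2 := (integrable_mul_exp_neg_mul_sq hc).norm
  refine (h1.add h2).congr (Eventually.of_forall fun x => ?_)
  simp only [Pi.add_apply, norm_mul, Real.norm_eq_abs, Real.abs_exp]
  ring

/-- Dominated convergence over growing symmetric intervals with a Gaussian majorant. -/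
theorem tendsto_intervalIntegral_of_gaussian_bound {ι E : Type*} [NormedAddCommGroup E]
    [NormedSpace ℝ E] {l : Filter ι} [l.IsCountablyGenerated] {F : ι → ℝ → E} {F₀ : ℝ → E}
    {T : ι → ℝ} {C c : ℝ} (hc : 0 < c) (hT : Tendsto T l atTop)
    (hcont : ∀ᶠ k in l, Continuous (F k))
    (hbound : ∀ᶠ k in l, ∀ x, |x| < T k → ‖F k x‖ ≤ C * ((1 + |x|) * Real.exp (-c * x ^ 2)))
    (hlim : ∀ x, Tendsto (fun k => F k x) l (𝓝 (F₀ x))) :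
    Tendsto (fun k => ∫ x in (-(T k))..(T k), F k x) l (𝓝 (∫ x, F₀ x)) := by
  have h := tendsto_integral_filter_of_dominated_convergence (μ := volume)
    (F := fun k => (Set.Ioo (-(T k)) (T k)).indicator (F k)) (f := F₀)
    (fun x => |C| * ((1 + |x|) * Real.exp (-c * x ^ 2)))
    (by
      filter_upwards [hcont] with k hk
      exact hk.aestronglyMeasurable.indicator measurableSet_Ioo)
    (by
      filter_upwards [hbound] with k hk
      refine Eventually.of_forall fun x => ?_
      have h0 : 0 ≤ (1 + |x|) * Real.exp (-c * x ^ 2) := by positivity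
      by_cases hx : x ∈ Set.Ioo (-(T k)) (T k)
      · rw [Set.indicator_of_mem hx]
        exact (hk x (abs_lt.2 hx)).trans (mul_le_mul_of_nonneg_right (le_abs_self C) h0)
      · rw [Set.indicator_of_notMem hx, norm_zero]
        positivity)
    ((integrable_one_add_abs_mul_exp_neg_mul_sq hc).const_mul _)
    (by
      refine Eventually.of_forall fun x => (hlim x).congr' ?_
      filter_upwards [hT.eventually_gt_atTop |x|] with k hk
      rw [Set.indicator_of_mem]
      exact abs_lt.1 hk)
  refine h.congr' ?_
  filter_upwards [hT.eventually_ge_atTop 0] with k hk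
  rw [integral_indicator measurableSet_Ioo, intervalIntegral.integral_of_le (by linarith),
    integral_Ioc_eq_integral_Ioo]

theorem continuous_circlePoint (η : ℝ) (n : ℕ) : Continuous (circlePoint η n) := by
  unfold circlePoint
  fun_prop

theorem continuous_saddleIntegrand {f : ℂ → ℂ} (hf : Differentiable ℂ f) (a b : ℂ) {lam : ℝ}
    (η : ℝ) {n : ℕ} (hG : saddleScale a b lam n ≠ 0) :
    Continuous (saddleIntegrand f a b lam η n) := by
  unfold saddleIntegrand
  refine Continuous.div (hf.continuous.comp (continuous_const.mul (continuous_circlePoint η n)))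
    (continuous_const.mul ((continuous_circlePoint η n).pow n)) fun x => ?_
  exact mul_ne_zero hG (pow_ne_zero _ (circlePoint_ne_zero η n x))

theorem tendsto_pi_mul_sqrt : Tendsto (fun n : ℕ => Real.pi * Real.sqrt n) atTop atTop :=
  tendsto_sqrt_natCast.const_mul_atTop Real.pi_pos

variable {a b : ℂ} {lam θ μ : ℝ} {f : ℂ → ℂ}

/-- Common form of the near and far limits. Linear growth of `κ` is allowed because multiplication
by `√n (1 - z)` in the far case produces a factor of order `1 + |x|`. -/
theorem OneDirectionGrowth.tendsto_integral_saddleIntegrand_mul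
    (hf : OneDirectionGrowth a b lam θ μ f) (hlam : 0 < lam) (hθ : 0 < θ) (hθπ : θ < Real.pi)
    (hμ : μ < 1) (hdir : lam * θ < 2 * Real.pi) (η : ℝ) {n : ℕ → ℕ} (hn : Tendsto n atTop atTop)
    {κ : ℕ → ℝ → ℂ} {κ₀ : ℝ → ℂ} {D : ℝ} (hcont : ∀ᶠ k in atTop, Continuous (κ k))
    (hbound : ∀ᶠ k in atTop, ∀ x, |x| < Real.pi * Real.sqrt (n k) → ‖κ k x‖ ≤ D * (1 + |x|))
    (hlim : ∀ x, Tendsto (fun k => κ k x) atTop (𝓝 (κ₀ x))) :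
    Tendsto (fun k => ∫ x in (-(Real.pi * Real.sqrt (n k)))..(Real.pi * Real.sqrt (n k)),
      saddleIntegrand f a b lam η (n k) x * κ k x) atTop
      (𝓝 (∫ x : ℝ, Complex.exp (lam * (η + x * Complex.I) ^ 2 / 2) * κ₀ x)) := by
  obtain ⟨C, hC, c, hc, hH⟩ := hf.exists_norm_saddleIntegrand_le hlam hθ hμ hdir η
  refine tendsto_intervalIntegral_of_gaussian_bound (C := C * D) hc
    (tendsto_pi_mul_sqrt.comp hn) ?_ ?_ fun x => ?_
  · filter_upwards [hcont, hn.eventually ((tendsto_scaleRadius hlam).eventually_gt_atTop 1)]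
      with k hk hr
    exact (continuous_saddleIntegrand hf.entire a b η (saddleScale_ne_zero a b hr)).mul hk
  · filter_upwards [hbound, hn.eventually hH] with k hk hHk x hx
    rw [norm_mul]
    calc _ ≤ (C * Real.exp (-c * x ^ 2)) * (D * (1 + |x|)) :=
          mul_le_mul (hHk x hx) (hk x hx) (norm_nonneg _) (by positivity)
      _ = _ := by ring
  · exact ((hf.tendsto_saddleIntegrand hlam hθ hθπ η x).comp hn).mul (hlim x)

/-- The explicit value of the limit matters: it must be small enough, for a suitable `η`, to bound
the Cauchy integral below `1` near `z₀ = 1`. -/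
theorem OneDirectionGrowth.tendsto_integral_norm_saddleIntegrand
    (hf : OneDirectionGrowth a b lam θ μ f) (hlam : 0 < lam) (hθ : 0 < θ) (hθπ : θ < Real.pi)
    (hμ : μ < 1) (hdir : lam * θ < 2 * Real.pi) (η : ℝ) :
    Tendsto (fun n : ℕ => ∫ x in (-(Real.pi * Real.sqrt n))..(Real.pi * Real.sqrt n),
      ‖saddleIntegrand f a b lam η n x‖) atTop
      (𝓝 (Real.exp (lam * η ^ 2 / 2) * Real.sqrt (2 * Real.pi / lam))) := by
  obtain ⟨C, hC, c, hc, hH⟩ := hf.exists_norm_saddleIntegrand_le hlam hθ hμ hdir η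
  have h := tendsto_intervalIntegral_of_gaussian_bound (l := atTop) (T := fun n : ℕ =>
    Real.pi * Real.sqrt n) (F := fun n x => ‖saddleIntegrand f a b lam η n x‖)
    (F₀ := fun x : ℝ => ‖Complex.exp (lam * (η + x * Complex.I) ^ 2 / 2)‖) (C := C) hc
    tendsto_pi_mul_sqrt ?_ ?_ fun x => ?_
  · convert h using 2
    have he : ∀ x : ℝ, ‖Complex.exp (lam * (η + x * Complex.I) ^ 2 / 2)‖ =
        Real.exp (lam * η ^ 2 / 2) * Real.exp (-(lam / 2) * x ^ 2) := by
      intro x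
      rw [Complex.norm_exp, ← Real.exp_add]
      congr 1
      have : (lam * (η + x * Complex.I) ^ 2 / 2 : ℂ) =
          ((lam * η ^ 2 / 2 + -(lam / 2) * x ^ 2 : ℝ) : ℂ) +
            ((lam * η * x : ℝ) : ℂ) * Complex.I := by
        push_cast
        ring_nf
        rw [Complex.I_sq]
        ring
      rw [this, Complex.add_re, Complex.re_ofReal_mul, Complex.ofReal_re, Complex.I_re]
      ring
    simp only [he]
    rw [integral_const_mul, integral_gaussian]
    congr 2
    field_simp
  · filter_upwards [(tendsto_scaleRadius hlam).eventually_gt_atTop 1] with n hr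
    exact (continuous_saddleIntegrand hf.entire a b η (saddleScale_ne_zero a b hr)).norm
  · filter_upwards [hH] with n hHn x hx
    rw [norm_norm]
    refine (hHn x hx).trans ?_
    have h0 : 0 ≤ C * Real.exp (-c * x ^ 2) := by positivity
    nlinarith [abs_nonneg x]
  · exact (hf.tendsto_saddleIntegrand hlam hθ hθπ η x).norm

theorem integral_saddle_gaussian_ne_zero {lam : ℝ} (hlam : 0 < lam) (η : ℝ) :
    (∫ x : ℝ, Complex.exp (lam * (η + x * Complex.I) ^ 2 / 2)) ≠ 0 := by
  have hre : 0 < ((lam / 2 : ℝ) : ℂ).re := by rw [Complex.ofReal_re]; positivity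
  have h := GaussianFourier.integral_cexp_neg_mul_sq_add_real_mul_I hre (-η)
  have he : ∀ x : ℝ, Complex.exp (lam * (η + x * Complex.I) ^ 2 / 2) =
      Complex.exp (-((lam / 2 : ℝ) : ℂ) * (x + ((-η : ℝ) : ℂ) * Complex.I) ^ 2) := by
    intro x
    congr 1
    push_cast
    ring_nf
    rw [Complex.I_sq]
    ring
  simp only [he]
  rw [h]
  simp [Complex.cpow_eq_zero_iff, hlam.ne']

/-- A Gaussian Cauchy transform has no zeros off its line of integration. -/
theorem integral_gaussian_div_ne_zero {lam : ℝ} (hlam : 0 < lam) {ω : ℂ} (hω : 0 < ω.re) :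
    (∫ x : ℝ, Complex.exp (lam * (((0 : ℝ) : ℂ) + x * Complex.I) ^ 2 / 2) *
      (x * Complex.I - ω)⁻¹) ≠ 0 := by
  have he : ∀ x : ℝ, Complex.exp (lam * (((0 : ℝ) : ℂ) + x * Complex.I) ^ 2 / 2) =
      (Real.exp (-(lam / 2) * x ^ 2) : ℂ) := by
    intro x
    rw [Complex.ofReal_exp]
    congr 1
    push_cast
    rw [zero_add, mul_pow, Complex.I_sq]
    ring
  simp only [he]
  have hre : ∀ x : ℝ, (x * Complex.I - ω).re = -ω.re := by intro x; simp
  have hne : ∀ x : ℝ, x * Complex.I - ω ≠ 0 := by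
    intro x h
    have := hre x
    rw [h, Complex.zero_re] at this
    linarith
  have hnorm : ∀ x : ℝ, ω.re ≤ ‖x * Complex.I - ω‖ := by
    intro x
    have := Complex.abs_re_le_norm (x * Complex.I - ω)
    rwa [hre, abs_neg, abs_of_pos hω] at this
  have hint : Integrable fun x : ℝ =>
      (Real.exp (-(lam / 2) * x ^ 2) : ℂ) * (x * Complex.I - ω)⁻¹ := by
    refine Integrable.mono' ((integrable_exp_neg_mul_sq (half_pos hlam)).mul_const ω.re⁻¹) ?_ ?_
    · refine Continuous.aestronglyMeasurable (Continuous.mul (by fun_prop)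
        (Continuous.inv₀ (by fun_prop) hne))
    · refine Eventually.of_forall fun x => ?_
      rw [norm_mul, norm_inv, Complex.norm_real, Real.norm_of_nonneg (Real.exp_pos _).le]
      have := hnorm x
      gcongr
  intro h0
  have h1 : (∫ x : ℝ, ((Real.exp (-(lam / 2) * x ^ 2) : ℂ) * (x * Complex.I - ω)⁻¹).re) = 0 := by
    have := Complex.reCLM.integral_comp_comm hint
    rw [h0] at this
    simpa only [Complex.reCLM_apply, Complex.zero_re] using this
  -- On the imaginary line the Gaussian weight is positive and `(i x - ω)⁻¹` has real part of
  -- constant sign, so the real part of the integral cannot vanish.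
  have hval : ∀ x : ℝ, -((Real.exp (-(lam / 2) * x ^ 2) : ℂ) * (x * Complex.I - ω)⁻¹).re =
      Real.exp (-(lam / 2) * x ^ 2) * (ω.re / Complex.normSq (x * Complex.I - ω)) := by
    intro x
    rw [Complex.re_ofReal_mul, Complex.inv_re, hre]
    ring
  have hpos : ∀ x : ℝ, 0 < -((Real.exp (-(lam / 2) * x ^ 2) : ℂ) * (x * Complex.I - ω)⁻¹).re := by
    intro x
    rw [hval]
    have := Complex.normSq_pos.2 (hne x)
    positivity
  have h2 : 0 < ∫ x : ℝ, -((Real.exp (-(lam / 2) * x ^ 2) : ℂ) * (x * Complex.I - ω)⁻¹).re := by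
    rw [integral_pos_iff_support_of_nonneg (fun x => (hpos x).le) hint.re.neg]
    have : (Function.support fun x : ℝ =>
        -((Real.exp (-(lam / 2) * x ^ 2) : ℂ) * (x * Complex.I - ω)⁻¹).re) = Set.univ :=
      Set.eq_univ_of_forall fun x => (hpos x).ne'
    rw [this]
    simp
  rw [integral_neg, h1, neg_zero] at h2
  exact lt_irrefl _ h2

end DominatedLimits

/-! ### Kernel estimates and limits of the Cauchy integral. -/

section CauchyKernel

open MeasureTheory

/-- A gap of `d / √n` in `log ‖q‖` forces `|1 - q|` to be nearly `d / √n`, relative to `‖q‖` when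
`‖q‖ > 1`. The `max` controls both the kernel and the kernel times `q`, without bounding `q`. -/
theorem eventually_mul_max_le_sqrt_mul_norm_one_sub {d d' : ℝ} (hd : 0 < d) (hd' : d' < d) :
    ∀ᶠ n : ℕ in atTop, ∀ q : ℂ,
      (‖q‖ ≤ Real.exp (-d / Real.sqrt n) ∨ Real.exp (d / Real.sqrt n) ≤ ‖q‖) →
        d' * max 1 ‖q‖ ≤ Real.sqrt n * ‖1 - q‖ := by
  have h1 : Tendsto (fun n : ℕ => d / Real.sqrt n) atTop (𝓝 0) :=
    tendsto_sqrt_natCast.const_div_atTop _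
  -- This is `√n (y - y²)` at `y = d / √n`, the lower bound for `√n (1 - e^{-y})`.
  have h2 : Tendsto (fun n : ℕ => d - d * (d / Real.sqrt n)) atTop (𝓝 d) := by
    simpa using (h1.const_mul d).const_sub d
  filter_upwards [h2.eventually_const_le hd', h1.eventually_le_const one_pos,
    tendsto_sqrt_natCast.eventually_gt_atTop 0] with n hn hn1 hS q hq
  set S := Real.sqrt n
  have hy0 : 0 < d / S := by positivity
  have hquad := (abs_le.1 (Real.abs_exp_sub_one_sub_id_le (x := -(d / S))
    (by rw [abs_neg, abs_of_pos hy0]; exact hn1))).2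
  have hgap : d' ≤ S * (1 - Real.exp (-d / S)) := by
    rw [neg_div]
    have h3 : d / S - (d / S) ^ 2 ≤ 1 - Real.exp (-(d / S)) := by nlinarith
    have h4 := mul_le_mul_of_nonneg_left h3 hS.le
    have h5 : S * (d / S - (d / S) ^ 2) = d - d * (d / S) := by field_simp
    linarith
  rcases hq with hq | hq
  · have hle1 : ‖q‖ ≤ 1 := hq.trans (by rw [Real.exp_le_one_iff, neg_div]; linarith)
    rw [max_eq_left hle1, mul_one]
    refine hgap.trans (mul_le_mul_of_nonneg_left ?_ hS.le)
    have := norm_sub_norm_le (1 : ℂ) q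
    rw [norm_one] at this
    linarith
  · have hge1 : 1 ≤ ‖q‖ := (Real.one_le_exp hy0.le).trans hq
    rw [max_eq_right hge1]
    have h3 := norm_sub_norm_le q (1 : ℂ)
    rw [norm_one, norm_sub_rev] at h3
    have h4 : ‖q‖ * (1 - Real.exp (-d / S)) ≤ ‖q‖ - 1 := by
      have h5 : 1 ≤ ‖q‖ * Real.exp (-d / S) := by
        rw [neg_div, Real.exp_neg, ← div_eq_mul_inv, le_div_iff₀ (Real.exp_pos _), one_mul]
        exact hq
      linarith
    calc d' * ‖q‖ ≤ S * (1 - Real.exp (-d / S)) * ‖q‖ := by gcongr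
      _ = S * (‖q‖ * (1 - Real.exp (-d / S))) := by ring
      _ ≤ S * ‖1 - q‖ := by gcongr; linarith

/-- The modulus of `z` differs from the radius `exp (η / √n)` by at least a factor
`exp (d / √n)`. -/
def RadiallySeparated (η d : ℝ) (n : ℕ) (z : ℂ) : Prop :=
  ‖z‖ ≤ Real.exp ((η - d) / Real.sqrt n) ∨ Real.exp ((η + d) / Real.sqrt n) ≤ ‖z‖

theorem RadiallySeparated.norm_div_circlePoint {η d : ℝ} {n : ℕ} {z : ℂ}
    (h : RadiallySeparated η d n z) (x : ℝ) :
    ‖z / circlePoint η n x‖ ≤ Real.exp (-d / Real.sqrt n) ∨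
      Real.exp (d / Real.sqrt n) ≤ ‖z / circlePoint η n x‖ := by
  rw [norm_div, norm_circlePoint, div_le_iff₀ (Real.exp_pos _), le_div_iff₀ (Real.exp_pos _),
    ← Real.exp_add, ← Real.exp_add, ← add_div, ← add_div]
  rw [neg_add_eq_sub, add_comm d η]
  exact h

theorem eventually_kernel_bound (η : ℝ) {d d' : ℝ} (hd : 0 < d) (hd' : d' < d) :
    ∀ᶠ n : ℕ in atTop, ∀ z : ℂ, RadiallySeparated η d n z → ∀ x : ℝ,
      d' * max 1 ‖z / circlePoint η n x‖ ≤
        ‖(Real.sqrt n : ℂ) * (1 - z / circlePoint η n x)‖ := by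
  filter_upwards [eventually_mul_max_le_sqrt_mul_norm_one_sub hd hd'] with n hn z hz x
  rw [norm_mul, Complex.norm_real, Real.norm_of_nonneg (Real.sqrt_nonneg _)]
  exact hn _ (hz.norm_div_circlePoint x)

theorem norm_inv_le_of_mul_max_le {d' M : ℝ} {w : ℂ} (hd' : 0 < d') (h : d' * max 1 M ≤ ‖w‖) :
    ‖w⁻¹‖ ≤ d'⁻¹ := by
  rw [norm_inv]
  gcongr
  refine le_trans ?_ h
  nlinarith [le_max_left 1 M]

theorem ne_zero_of_mul_max_le {d' M : ℝ} {w : ℂ} (hd' : 0 < d') (h : d' * max 1 M ≤ ‖w‖) :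
    w ≠ 0 := by
  rw [← norm_pos_iff]
  refine lt_of_lt_of_le ?_ h
  have : 0 < max 1 M := lt_of_lt_of_le one_pos (le_max_left _ _)
  positivity

theorem continuous_kernel {η d' : ℝ} {n : ℕ} {z : ℂ} (hd' : 0 < d')
    (h : ∀ x : ℝ, d' * max 1 ‖z / circlePoint η n x‖ ≤
      ‖(Real.sqrt n : ℂ) * (1 - z / circlePoint η n x)‖) :
    Continuous fun x => ((Real.sqrt n : ℂ) * (1 - z / circlePoint η n x))⁻¹ := by
  refine Continuous.inv₀ (continuous_const.mul (continuous_const.sub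
    (continuous_const.div (continuous_circlePoint η n) (circlePoint_ne_zero η n)))) fun x => ?_
  exact ne_zero_of_mul_max_le hd' (h x)

theorem tendsto_sqrt_mul_circlePoint_sub_one (η x : ℝ) :
    Tendsto (fun n : ℕ => (Real.sqrt n : ℂ) * (circlePoint η n x - 1)) atTop
      (𝓝 (η + x * Complex.I)) := by
  set u : ℂ := η + x * Complex.I with hu
  have ho := (Complex.exp_sub_sum_range_succ_isLittleO_pow 1).comp_tendsto
    (tendsto_div_sqrt_natCast u)
  have hmul : ∀ n : ℕ, 0 < n → (Real.sqrt n : ℂ) * (u / (Real.sqrt n : ℂ)) = u := by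
    intro n hn
    have : (Real.sqrt n : ℂ) ≠ 0 := by
      exact_mod_cast (Real.sqrt_pos.2 (by exact_mod_cast hn)).ne'
    field_simp
  have h1 := (isBigO_refl (fun n : ℕ => (Real.sqrt n : ℂ)) atTop).mul_isLittleO ho
  have h2 : Tendsto (fun n : ℕ => (Real.sqrt n : ℂ) * (Complex.exp (u / (Real.sqrt n : ℂ)) -
      ∑ i ∈ Finset.range (1 + 1), (u / (Real.sqrt n : ℂ)) ^ i / (i.factorial : ℂ)))
      atTop (𝓝 0) := by
    rw [← isLittleO_one_iff ℂ]
    refine h1.trans_isBigO (IsBigO.of_bound ‖u‖ ?_)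
    filter_upwards [eventually_gt_atTop 0] with n hn
    simp only [Function.comp_apply, pow_one]
    rw [hmul n hn]
    simp
  have h3 := h2.add_const u
  rw [zero_add] at h3
  refine h3.congr' ?_
  filter_upwards [eventually_gt_atTop 0] with n hn
  rw [circlePoint, ← hu]
  nth_rw 3 [← hmul n hn]
  simp [Finset.sum_range_succ]
  ring

theorem sqrt_mul_norm_one_sub_circlePoint_le (η : ℝ) {n : ℕ} (hn : 0 < n) {x : ℝ}
    (hx : |x| < Real.pi * Real.sqrt n) :
    Real.sqrt n * ‖1 - circlePoint η n x‖ ≤ Real.exp (|η| + Real.pi) * (|η| + |x|) := by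
  have hS1 : 1 ≤ Real.sqrt n := by rw [Real.one_le_sqrt]; exact_mod_cast hn
  have hS : 0 < Real.sqrt n := by linarith
  have hu : ‖(η + x * Complex.I : ℂ)‖ ≤ |η| + |x| := by
    refine (norm_add_le _ _).trans ?_
    simp
  have hdiv : ‖(η + x * Complex.I : ℂ) / (Real.sqrt n : ℂ)‖ ≤ (|η| + |x|) / Real.sqrt n := by
    rw [norm_div, Complex.norm_real, Real.norm_of_nonneg hS.le]
    gcongr
  have hdiv2 : (|η| + |x|) / Real.sqrt n ≤ |η| + Real.pi := by
    rw [div_le_iff₀ hS]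
    nlinarith [abs_nonneg η]
  have h := Complex.norm_exp_sub_sum_le_norm_mul_exp
    ((η + x * Complex.I : ℂ) / (Real.sqrt n : ℂ)) 1
  simp only [Finset.range_one, Finset.sum_singleton, pow_zero, Nat.factorial_zero, Nat.cast_one,
    div_one, pow_one] at h
  rw [norm_sub_rev, circlePoint]
  calc Real.sqrt n * ‖Complex.exp ((η + x * Complex.I) / (Real.sqrt n : ℂ)) - 1‖
      ≤ Real.sqrt n * ((|η| + |x|) / Real.sqrt n * Real.exp (|η| + Real.pi)) := by
        gcongr
        refine h.trans ?_
        gcongr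
        exact hdiv.trans hdiv2
    _ = _ := by field_simp

variable {a b : ℂ} {lam θ μ : ℝ} {f : ℂ → ℂ}

/-- Cauchy integrals at points whose distance to `1` is large compared with `1 / √n`. -/
theorem OneDirectionGrowth.tendsto_cauchySaddleIntegral_far
    (hf : OneDirectionGrowth a b lam θ μ f) (hlam : 0 < lam) (hθ : 0 < θ) (hθπ : θ < Real.pi)
    (hμ : μ < 1) (hdir : lam * θ < 2 * Real.pi) {η d : ℝ} (hd : 0 < d) {n : ℕ → ℕ} {z : ℕ → ℂ}
    {z₀ : ℂ} (hn : Tendsto n atTop atTop) (hz : Tendsto z atTop (𝓝 z₀))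
    (hsep : ∀ᶠ k in atTop, RadiallySeparated η d (n k) (z k))
    (hfar : Tendsto (fun k => Real.sqrt (n k) * ‖1 - z k‖) atTop atTop) :
    Tendsto (fun k => (Real.sqrt (n k) : ℂ) * (1 - z k) *
      cauchySaddleIntegral f a b lam η (n k) (z k)) atTop
      (𝓝 ((2 * Real.pi : ℂ)⁻¹ *
        ∫ x : ℝ, Complex.exp (lam * (η + x * Complex.I) ^ 2 / 2))) := by
  have hd2 : 0 < d / 2 := half_pos hd
  have hK := hn.eventually (eventually_kernel_bound η hd (half_lt_self hd))
  set E := Real.exp (|η| + Real.pi) with hE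
  have hlim : ∀ x : ℝ, Tendsto (fun k => (Real.sqrt (n k) : ℂ) * (1 - z k) *
      ((Real.sqrt (n k) : ℂ) * (1 - z k / circlePoint η (n k) x))⁻¹) atTop (𝓝 1) := by
    intro x
    have h1 := (tendsto_sqrt_mul_circlePoint_sub_one η x).comp hn
    have h2 := (tendsto_circlePoint η x).comp hn
    have h3 : Tendsto (fun k => ((Real.sqrt (n k) : ℂ) * (1 - z k))⁻¹) atTop (𝓝 0) := by
      rw [tendsto_zero_iff_norm_tendsto_zero]
      refine hfar.inv_tendsto_atTop.congr fun k => ?_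
      rw [Pi.inv_apply, norm_inv, norm_mul, Complex.norm_real,
        Real.norm_of_nonneg (Real.sqrt_nonneg _)]
    -- The reciprocal ratio `(1 - z/s) / (1 - z)` equals `1 + (z/s) (s - 1) / (1 - z)`. Here `√n (s
    -- - 1)` converges while `√n (1 - z)` is unbounded, even if `z₀ = 1`.
    have h4 : Tendsto (fun k => 1 + z k / circlePoint η (n k) x *
        ((Real.sqrt (n k) : ℂ) * (circlePoint η (n k) x - 1)) *
          ((Real.sqrt (n k) : ℂ) * (1 - z k))⁻¹) atTop (𝓝 1) := by
      have := (((hz.div h2 one_ne_zero).mul h1).mul h3).const_add 1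
      simpa using this
    have h5 := h4.inv₀ one_ne_zero
    rw [inv_one] at h5
    refine h5.congr' ?_
    filter_upwards [hfar.eventually_gt_atTop 0, hK, hsep] with k hk hKk hsk
    have e1 : (Real.sqrt (n k) : ℂ) * (1 - z k) ≠ 0 := by
      rw [← norm_pos_iff, norm_mul, Complex.norm_real, Real.norm_of_nonneg (Real.sqrt_nonneg _)]
      exact hk
    have e2 := ne_zero_of_mul_max_le hd2 (hKk _ hsk x)
    have e3 := circlePoint_ne_zero η (n k) x
    rw [inv_eq_iff_eq_inv,
      ← div_eq_mul_inv _ ((Real.sqrt (n k) : ℂ) * (1 - z k / circlePoint η (n k) x)), inv_div, eq_div_iff e1, add_mul, one_mul,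
      inv_mul_cancel_right₀ e1]
    field_simp
    ring
  have h := hf.tendsto_integral_saddleIntegrand_mul hlam hθ hθπ hμ hdir η hn
    (κ := fun k x => (Real.sqrt (n k) : ℂ) * (1 - z k) *
      ((Real.sqrt (n k) : ℂ) * (1 - z k / circlePoint η (n k) x))⁻¹) (κ₀ := fun _ => 1)
    (D := 1 + (d / 2)⁻¹ * (E * (|η| + 1))) ?_ ?_ hlim
  · simp only [mul_one] at h
    refine (h.const_mul _).congr fun k => ?_
    rw [cauchySaddleIntegral, mul_left_comm]
    congr 1
    rw [← intervalIntegral.integral_const_mul]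
    refine intervalIntegral.integral_congr fun x _ => ?_
    ring
  · filter_upwards [hK, hsep] with k hKk hsk
    exact continuous_const.mul (continuous_kernel hd2 (hKk _ hsk))
  · filter_upwards [hK, hsep, hn.eventually_gt_atTop 0] with k hKk hsk hnk x hx
    have hb := hKk _ hsk x
    have e2 := ne_zero_of_mul_max_le hd2 hb
    have e3 := circlePoint_ne_zero η (n k) x
    have hs := sqrt_mul_norm_one_sub_circlePoint_le η hnk hx
    set w := (Real.sqrt (n k) : ℂ) * (1 - z k / circlePoint η (n k) x) with hw
    -- Removing the leading `1` leaves `(z/s) w⁻¹`, bounded by the `max` in the kernel estimate,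
    -- times `√n (1 - s)`, which grows at most linearly in `x`.
    have hsplit : (Real.sqrt (n k) : ℂ) * (1 - z k) * w⁻¹ =
        1 + (z k / circlePoint η (n k) x) * w⁻¹ *
          ((Real.sqrt (n k) : ℂ) * (1 - circlePoint η (n k) x)) := by
      have : (Real.sqrt (n k) : ℂ) * (1 - z k) = w + (z k / circlePoint η (n k) x) *
          ((Real.sqrt (n k) : ℂ) * (1 - circlePoint η (n k) x)) := by
        rw [hw]
        field_simp
        ring
      rw [this, add_mul, mul_inv_cancel₀ e2]
      ring
    have hq : ‖z k / circlePoint η (n k) x‖ * ‖w⁻¹‖ ≤ (d / 2)⁻¹ := by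
      rw [norm_inv, ← div_eq_mul_inv, div_le_iff₀ (norm_pos_iff.2 e2), ← div_eq_inv_mul,
        le_div_iff₀ hd2]
      refine le_trans ?_ hb
      rw [mul_comm]
      gcongr
      exact le_max_right _ _
    rw [hsplit]
    refine (norm_add_le _ _).trans ?_
    rw [norm_one, norm_mul, norm_mul, norm_mul, Complex.norm_real,
      Real.norm_of_nonneg (Real.sqrt_nonneg _)]
    have hx0 := abs_nonneg x
    have hη0 := abs_nonneg η
    have hE0 : 0 < E := Real.exp_pos _
    calc 1 + ‖z k / circlePoint η (n k) x‖ * ‖w⁻¹‖ *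
          (Real.sqrt (n k) * ‖1 - circlePoint η (n k) x‖)
        ≤ 1 + (d / 2)⁻¹ * (E * (|η| + |x|)) := by gcongr
      _ ≤ 1 * (1 + |x|) + (d / 2)⁻¹ * (E * ((|η| + 1) * (1 + |x|))) := by
          gcongr
          · linarith
          · nlinarith
      _ = _ := by ring

/-- Cauchy integrals at points whose distance to `1` is comparable with `1 / √n`. -/
theorem OneDirectionGrowth.tendsto_cauchySaddleIntegral_near
    (hf : OneDirectionGrowth a b lam θ μ f) (hlam : 0 < lam) (hθ : 0 < θ) (hθπ : θ < Real.pi)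
    (hμ : μ < 1) (hdir : lam * θ < 2 * Real.pi) {η d : ℝ} (hd : 0 < d) {n : ℕ → ℕ} {z : ℕ → ℂ}
    {ω : ℂ} (hn : Tendsto n atTop atTop)
    (hsep : ∀ᶠ k in atTop, RadiallySeparated η d (n k) (z k))
    (hnear : Tendsto (fun k => (Real.sqrt (n k) : ℂ) * (z k - 1)) atTop (𝓝 ω))
    (hω : ω.re ≠ η) :
    Tendsto (fun k => cauchySaddleIntegral f a b lam η (n k) (z k)) atTop
      (𝓝 ((2 * Real.pi : ℂ)⁻¹ * ∫ x : ℝ,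
        Complex.exp (lam * (η + x * Complex.I) ^ 2 / 2) * (η + x * Complex.I - ω)⁻¹)) := by
  have hd2 : 0 < d / 2 := half_pos hd
  have hK := hn.eventually (eventually_kernel_bound η hd (half_lt_self hd))
  refine (hf.tendsto_integral_saddleIntegrand_mul hlam hθ hθπ hμ hdir η hn
    (D := (d / 2)⁻¹) ?_ ?_ fun x => ?_).const_mul _
  · filter_upwards [hK, hsep] with k hKk hsk
    exact continuous_kernel hd2 (hKk _ hsk)
  · filter_upwards [hK, hsep] with k hKk hsk x _
    refine (norm_inv_le_of_mul_max_le hd2 (hKk _ hsk x)).trans ?_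
    have h1 : 0 < (d / 2)⁻¹ := by positivity
    nlinarith [abs_nonneg x]
  · have h1 := (tendsto_sqrt_mul_circlePoint_sub_one η x).comp hn
    have h2 := (tendsto_circlePoint η x).comp hn
    have h3 := (h1.sub hnear).div h2 one_ne_zero
    rw [div_one] at h3
    refine (h3.congr fun k => ?_).inv₀ ?_
    · have := circlePoint_ne_zero η (n k) x
      simp only [Pi.div_apply, Function.comp_apply]
      field_simp
      ring
    · intro h0
      apply hω
      have := congrArg Complex.re h0
      simp at this
      linarith

/-- Bounding the kernel by `1 / d'` and integrating absolute values needs no information on how `√n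
(1 - z)` behaves, so it covers all approaches to `1` at once. -/
theorem OneDirectionGrowth.eventually_norm_cauchySaddleIntegral_le
    (hf : OneDirectionGrowth a b lam θ μ f) (hlam : 0 < lam) (hθ : 0 < θ) (hθπ : θ < Real.pi)
    (hμ : μ < 1) (hdir : lam * θ < 2 * Real.pi) {η d d' M : ℝ} (hd' : 0 < d') (hd : d' < d)
    (hM : Real.exp (lam * η ^ 2 / 2) * Real.sqrt (2 * Real.pi / lam) < 2 * Real.pi * d' * M) :
    ∀ᶠ n : ℕ in atTop, ∀ z, RadiallySeparated η d n z →
      ‖cauchySaddleIntegral f a b lam η n z‖ ≤ M := by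
  filter_upwards [(hf.tendsto_integral_norm_saddleIntegrand hlam hθ hθπ hμ hdir
    η).eventually_le_const hM, eventually_kernel_bound η (hd'.trans hd) hd,
    (tendsto_scaleRadius hlam).eventually_gt_atTop 1] with n hn hK hr z hz
  have hT : -(Real.pi * Real.sqrt n) ≤ Real.pi * Real.sqrt n := by
    have : 0 ≤ Real.pi * Real.sqrt n := by positivity
    linarith
  have hcont := continuous_saddleIntegrand hf.entire a b η (saddleScale_ne_zero a b hr)
  have h1 : ‖∫ x in (-(Real.pi * Real.sqrt n))..(Real.pi * Real.sqrt n),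
      saddleIntegrand f a b lam η n x * ((Real.sqrt n : ℂ) * (1 - z / circlePoint η n x))⁻¹‖ ≤
      ∫ x in (-(Real.pi * Real.sqrt n))..(Real.pi * Real.sqrt n),
        d'⁻¹ * ‖saddleIntegrand f a b lam η n x‖ := by
    refine intervalIntegral.norm_integral_le_of_norm_le hT (Eventually.of_forall fun x _ => ?_)
      ((continuous_const.mul hcont.norm).intervalIntegrable _ _)
    rw [norm_mul, mul_comm]
    gcongr
    exact norm_inv_le_of_mul_max_le hd' (hK z hz x)
  rw [intervalIntegral.integral_const_mul] at h1
  rw [cauchySaddleIntegral, norm_mul, norm_inv, norm_mul, Complex.norm_real, Complex.norm_ofNat,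
    Real.norm_of_nonneg Real.pi_pos.le]
  calc _ ≤ (2 * Real.pi)⁻¹ * (d'⁻¹ * (2 * Real.pi * d' * M)) := by
        gcongr
        exact h1.trans (by gcongr)
    _ = M := by field_simp

end CauchyKernel

/-! ### Zeros and the unit circle. -/

section Zeros

variable {a b : ℂ} {lam θ μ : ℝ} {f : ℂ → ℂ}

theorem ZerosTendTo.comp {n : ℕ → ℕ} {z : ℕ → ℂ} {z₀ : ℂ} (h : ZerosTendTo f lam n z z₀)
    {φ : ℕ → ℕ} (hφ : StrictMono φ) : ZerosTendTo f lam (n ∘ φ) (z ∘ φ) z₀ :=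
  ⟨h.1.comp hφ.tendsto_atTop, fun k => h.2.1 (φ k), h.2.2.comp hφ.tendsto_atTop⟩

/-- Outside the circle of radius `exp (η / √n)`, zeros make the Cauchy integral vanish. -/
theorem cauchySaddleIntegral_eq_zero (hf : Differentiable ℂ f) (hlam : 0 < lam) (a b : ℂ) {η : ℝ}
    {n : ℕ} (hn : 0 < n) (hr : 1 < scaleRadius lam n) {z : ℂ} (hz0 : z ≠ 0)
    (hz : Real.exp (η / Real.sqrt n) < ‖z‖)
    (hzero : maclaurinSum f n (scaleRadius lam n * z) = 0) :
    cauchySaddleIntegral f a b lam η n z = 0 := by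
  have hG := saddleScale_ne_zero a b hr
  rw [maclaurinSum_scaled hf a b hlam η hn hG hz.ne', if_neg (not_lt.2 hz.le), zero_sub,
    neg_eq_zero] at hzero
  exact (mul_eq_zero.1 hzero).resolve_left (mul_ne_zero (pow_ne_zero _ hz0) hG)

/-- Inside the circle of radius `exp (η / √n)`, zeros equate `f` with the Cauchy integral. -/
theorem cauchySaddleIntegral_eq_div (hf : Differentiable ℂ f) (hlam : 0 < lam) (a b : ℂ) {η : ℝ}
    {n : ℕ} (hn : 0 < n) (hr : 1 < scaleRadius lam n) {z : ℂ} (hz0 : z ≠ 0)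
    (hz : ‖z‖ < Real.exp (η / Real.sqrt n))
    (hzero : maclaurinSum f n (scaleRadius lam n * z) = 0) :
    cauchySaddleIntegral f a b lam η n z =
      f (scaleRadius lam n * z) / (saddleScale a b lam n * z ^ n) := by
  have hG := saddleScale_ne_zero a b hr
  rw [maclaurinSum_scaled hf a b hlam η hn hG hz.ne, if_pos hz, sub_eq_zero] at hzero
  rw [eq_div_iff (mul_ne_zero hG (pow_ne_zero _ hz0)), hzero]
  ring

/-- There are no zeros outside the circle of radius `exp (ξ / √n)` near a nonzero point. -/
theorem OneDirectionGrowth.not_forall_exp_le_norm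
    (hf : OneDirectionGrowth a b lam θ μ f) (hlam : 0 < lam) (hθ : 0 < θ) (hθπ : θ < Real.pi)
    (hμ : μ < 1) (hdir : lam * θ < 2 * Real.pi) {ξ : ℝ} (hξ : 0 < ξ) {n : ℕ → ℕ} {z : ℕ → ℂ}
    {z₀ : ℂ} (h : ZerosTendTo f lam n z z₀)
    (hout : ∀ k, Real.exp (ξ / Real.sqrt (n k)) ≤ ‖z k‖) : False := by
  have hJ : ∀ {n : ℕ → ℕ} {z : ℕ → ℂ}, ZerosTendTo f lam n z z₀ →
      (∀ k, Real.exp (ξ / Real.sqrt (n k)) ≤ ‖z k‖) →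
      ∀ᶠ k in atTop, cauchySaddleIntegral f a b lam 0 (n k) (z k) = 0 := by
    intro n z h hout
    filter_upwards [h.1.eventually_gt_atTop 0,
      h.1.eventually ((tendsto_scaleRadius hlam).eventually_gt_atTop 1)] with k hk hr
    have hS : 0 < Real.sqrt (n k) := Real.sqrt_pos.2 (by exact_mod_cast hk)
    refine cauchySaddleIntegral_eq_zero hf.entire hlam a b hk hr ?_ ?_ (h.2.1 k)
    · rw [← norm_pos_iff]
      exact (Real.exp_pos _).trans_le (hout k)
    · refine lt_of_lt_of_le ?_ (hout k)
      rw [Real.exp_lt_exp]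
      gcongr
  have hsep : ∀ {n : ℕ → ℕ} {z : ℕ → ℂ}, (∀ k, Real.exp (ξ / Real.sqrt (n k)) ≤ ‖z k‖) →
      ∀ᶠ k in atTop, RadiallySeparated 0 ξ (n k) (z k) := by
    intro n z hout
    refine Eventually.of_forall fun k => Or.inr ?_
    rw [zero_add]
    exact hout k
  -- Either the far limit applies, or `√n (z - 1)` is bounded along a subsequence and converges
  -- along a further one, to which the near limit applies.
  by_cases hfar : Tendsto (fun k => Real.sqrt (n k) * ‖1 - z k‖) atTop atTop
  · have h1 := hf.tendsto_cauchySaddleIntegral_far hlam hθ hθπ hμ hdir hξ h.1 h.2.2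
      (hsep hout) hfar
    have h2 : Tendsto (fun k => (Real.sqrt (n k) : ℂ) * (1 - z k) *
        cauchySaddleIntegral f a b lam 0 (n k) (z k)) atTop (𝓝 0) := by
      refine tendsto_const_nhds.congr' ?_
      filter_upwards [hJ h hout] with k hk
      rw [hk, mul_zero]
    have h3 := tendsto_nhds_unique h1 h2
    refine mul_ne_zero (inv_ne_zero ?_) (integral_saddle_gaussian_ne_zero hlam 0) h3
    exact_mod_cast Real.two_pi_pos.ne'
  · have hfreq : ∃ R, ∃ᶠ k in atTop,
        (Real.sqrt (n k) : ℂ) * (z k - 1) ∈ Metric.ball (0 : ℂ) R := by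
      rw [tendsto_atTop] at hfar
      push Not at hfar
      obtain ⟨R, hR⟩ := hfar
      refine ⟨R, hR.mono fun k hk => ?_⟩
      rw [mem_ball_zero_iff, norm_mul, Complex.norm_real,
        Real.norm_of_nonneg (Real.sqrt_nonneg _), norm_sub_rev]
      exact hk
    obtain ⟨R, hR⟩ := hfreq
    obtain ⟨ω, -, φ, hφ, hω⟩ := tendsto_subseq_of_frequently_bounded Metric.isBounded_ball hR
    have hn' := (h.comp hφ).1
    have hout' : ∀ k, Real.exp (ξ / Real.sqrt ((n ∘ φ) k)) ≤ ‖(z ∘ φ) k‖ := fun k => hout (φ k)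
    have hnear : Tendsto (fun k => (Real.sqrt ((n ∘ φ) k) : ℂ) * ((z ∘ φ) k - 1)) atTop (𝓝 ω) := hω
    have hsq := tendsto_sqrt_natCast.comp hn'
    -- Expanding `‖1 + w / S‖²` against `‖z‖ ≥ 1 + ξ / S` gives `Re w ≥ ξ - O(1 / S)`. So `ω` lies
    -- strictly to the right of the line of integration.
    have hre : ξ ≤ ω.re := by
      have h1 : Tendsto (fun k => ξ - ‖(Real.sqrt ((n ∘ φ) k) : ℂ) * ((z ∘ φ) k - 1)‖ ^ 2 /
          (2 * Real.sqrt ((n ∘ φ) k))) atTop (𝓝 ξ) := by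
        have h2 := (hnear.norm.pow 2).div_atTop (hsq.const_mul_atTop two_pos)
        simpa using h2.const_sub ξ
      refine le_of_tendsto_of_tendsto h1 ((Complex.continuous_re.tendsto ω).comp hnear) ?_
      filter_upwards [hsq.eventually_gt_atTop 0] with k hk
      simp only [Function.comp_apply] at hk hout' ⊢
      set S := Real.sqrt (n (φ k)) with hS
      set w := (S : ℂ) * (z (φ k) - 1) with hw
      have hS' : (S : ℂ) ≠ 0 := by exact_mod_cast hk.ne'
      have hz : z (φ k) = 1 + ((S⁻¹ : ℝ) : ℂ) * w := by
        rw [hw]; push_cast; field_simp; ring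
      have h3 : 1 + ξ / S ≤ ‖z (φ k)‖ :=
        le_trans (by linarith [Real.add_one_le_exp (ξ / S)]) (hout' k)
      have h4 : ‖z (φ k)‖ ^ 2 = 1 + 2 * (S⁻¹ * w.re) + (S⁻¹) ^ 2 * ‖w‖ ^ 2 := by
        rw [hz, Complex.sq_norm, Complex.sq_norm, Complex.normSq_apply, Complex.normSq_apply,
          Complex.add_re, Complex.add_im, Complex.re_ofReal_mul, Complex.im_ofReal_mul,
          Complex.one_re, Complex.one_im]
        ring
      have h5 : (1 + ξ / S) ^ 2 ≤ ‖z (φ k)‖ ^ 2 := pow_le_pow_left₀ (by positivity) h3 2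
      rw [h4] at h5
      have h6 : 2 * (ξ / S) ≤ 2 * (S⁻¹ * w.re) + (S⁻¹) ^ 2 * ‖w‖ ^ 2 := by
        have : 0 ≤ (ξ / S) ^ 2 := sq_nonneg _
        nlinarith
      have h7 := mul_le_mul_of_nonneg_left h6 (half_pos hk).le
      have h8 : S / 2 * (2 * (ξ / S)) = ξ := by field_simp
      have h9 : S / 2 * (2 * (S⁻¹ * w.re) + (S⁻¹) ^ 2 * ‖w‖ ^ 2) =
          w.re + ‖w‖ ^ 2 / (2 * S) := by field_simp
      linarith
    have hω0 : 0 < ω.re := hξ.trans_le hre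
    have h1 := hf.tendsto_cauchySaddleIntegral_near hlam hθ hθπ hμ hdir hξ hn'
      (hsep hout') hnear hω0.ne'
    have h2 : Tendsto (fun k => cauchySaddleIntegral f a b lam 0 ((n ∘ φ) k) ((z ∘ φ) k))
        atTop (𝓝 0) := by
      refine tendsto_const_nhds.congr' ?_
      filter_upwards [hJ (h.comp hφ) hout'] with k hk
      rw [hk]
    have h3 := tendsto_nhds_unique h1 h2
    refine mul_ne_zero (inv_ne_zero ?_) ?_ h3
    · exact_mod_cast Real.two_pi_pos.ne'
    · have := integral_gaussian_div_ne_zero hlam hω0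
      simpa only [Complex.ofReal_zero, zero_add] using this

theorem OneDirectionGrowth.eventually_norm_lt_exp
    (hf : OneDirectionGrowth a b lam θ μ f) (hlam : 0 < lam) (hθ : 0 < θ) (hθπ : θ < Real.pi)
    (hμ : μ < 1) (hdir : lam * θ < 2 * Real.pi) {ξ : ℝ} (hξ : 0 < ξ) {n : ℕ → ℕ} {z : ℕ → ℂ}
    {z₀ : ℂ} (h : ZerosTendTo f lam n z z₀) :
    ∀ᶠ k in atTop, ‖z k‖ < Real.exp (ξ / Real.sqrt (n k)) := by
  by_contra hcon
  rw [not_eventually] at hcon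
  obtain ⟨φ, hφ, hout⟩ := extraction_of_frequently_atTop hcon
  exact hf.not_forall_exp_le_norm hlam hθ hθπ hμ hdir hξ (h.comp hφ) fun k => not_lt.1 (hout k)

theorem OneDirectionGrowth.norm_le_one_of_zerosTendTo
    (hf : OneDirectionGrowth a b lam θ μ f) (hlam : 0 < lam) (hθ : 0 < θ) (hθπ : θ < Real.pi)
    (hμ : μ < 1) (hdir : lam * θ < 2 * Real.pi) {n : ℕ → ℕ} {z : ℕ → ℂ} {z₀ : ℂ}
    (h : ZerosTendTo f lam n z z₀) : ‖z₀‖ ≤ 1 := by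
  have h1 : Tendsto (fun k => Real.exp (1 / Real.sqrt (n k))) atTop (𝓝 1) := by
    have h2 := (tendsto_sqrt_natCast.comp h.1).const_div_atTop 1
    simpa [Function.comp_def] using (Real.continuous_exp.tendsto 0).comp h2
  refine le_of_tendsto_of_tendsto h.2.2.norm h1 ?_
  filter_upwards [hf.eventually_norm_lt_exp hlam hθ hθπ hμ hdir one_pos h] with k hk using hk.le

/-! ### Curve modulus at the zeros. -/

theorem curveModulus_eq (lam : ℝ) (z : ℂ) :
    curveModulus lam z = ‖z‖ ^ lam * Real.exp (1 - (z ^ (lam : ℂ)).re) := by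
  rw [curveModulus, norm_mul, Complex.norm_exp, Complex.norm_cpow_real, Complex.sub_re,
    Complex.one_re]

theorem curveModulus_pos (lam : ℝ) {z : ℂ} (hz : z ≠ 0) : 0 < curveModulus lam z := by
  rw [curveModulus_eq lam z]
  have := norm_pos_iff.2 hz
  positivity

theorem curveModulus_one (lam : ℝ) : curveModulus lam 1 = 1 := by
  simp [curveModulus]

/-- Converts the ratio of `z ^ n` to the exponential in the asymptotics of `f (r_n z)` into a power
of the curve modulus. -/
theorem curveModulus_rpow {lam : ℝ} (hlam : 0 < lam) (n : ℕ) {z : ℂ} (hz : z ≠ 0) :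
    curveModulus lam z ^ ((n : ℝ) / lam) * ‖Complex.exp ((n / lam : ℝ) * (z ^ (lam : ℂ) - 1))‖ =
      ‖z ^ n‖ := by
  have hz' := norm_pos_iff.2 hz
  rw [curveModulus_eq lam z, Real.mul_rpow (by positivity) (by positivity), ← Real.rpow_mul
    hz'.le, ← Real.exp_mul, Complex.norm_exp, Complex.re_ofReal_mul, mul_div_cancel₀ _ hlam.ne',
    Real.rpow_natCast, mul_assoc, ← Real.exp_add, norm_pow, Complex.sub_re, Complex.one_re]
  have : (1 - (z ^ (lam : ℂ)).re) * ((n : ℝ) / lam) +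
      (n : ℝ) / lam * ((z ^ (lam : ℂ)).re - 1) = 0 := by ring
  rw [this, Real.exp_zero, mul_one]

theorem continuousAt_curveModulus (lam : ℝ) {z₀ : ℂ} (h : z₀ ∈ Complex.slitPlane) :
    ContinuousAt (curveModulus lam) z₀ := by
  have h1 : ContinuousAt (fun z : ℂ => z ^ (lam : ℂ)) z₀ :=
    continuousAt_id.cpow continuousAt_const h
  exact (h1.mul (Complex.continuous_exp.continuousAt.comp (continuousAt_const.sub h1))).norm

/-- At the zeros, the size of the Cauchy integral is governed by `curveModulus`. -/
theorem OneDirectionGrowth.tendsto_norm_cauchySaddleIntegral_mul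
    (hf : OneDirectionGrowth a b lam θ μ f) (hlam : 0 < lam) (hθπ : θ < Real.pi) {η : ℝ}
    {n : ℕ → ℕ} {z : ℕ → ℂ} {z₀ : ℂ} (hz₀ : z₀ ≠ 0) (harg : |Complex.arg z₀| < θ)
    (h : ZerosTendTo f lam n z z₀)
    (hin : ∀ᶠ k in atTop, ‖z k‖ < Real.exp (η / Real.sqrt (n k))) :
    Tendsto (fun k => ‖cauchySaddleIntegral f a b lam η (n k) (z k)‖ *
      curveModulus lam (z k) ^ ((n k : ℝ) / lam)) atTop (𝓝 ‖z₀ ^ a‖) := by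
  refine (hf.tendsto_rescaled hlam hθπ h.1 h.2.2 hz₀ harg).norm.congr' ?_
  filter_upwards [hin, h.1.eventually_gt_atTop 0, h.2.2.eventually_ne hz₀,
    h.1.eventually ((tendsto_scaleRadius hlam).eventually_gt_atTop 1)] with k hk hn hz hr
  rw [cauchySaddleIntegral_eq_div hf.entire hlam a b hn hr hz hk (h.2.1 k), norm_div, norm_div,
    norm_mul, norm_mul, ← curveModulus_rpow hlam (n k) hz]
  have h1 := norm_pos_iff.2 (saddleScale_ne_zero a b hr)
  have h2 := Real.rpow_pos_of_pos (curveModulus_pos lam hz) ((n k : ℝ) / lam)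
  have h3 := norm_pos_iff.2 (Complex.exp_ne_zero ((n k / lam : ℝ) * (z k ^ (lam : ℂ) - 1)))
  field_simp

theorem radiallySeparated_of_norm_lt {η d : ℝ} {n : ℕ} {z : ℂ}
    (h : ‖z‖ < Real.exp ((η - d) / Real.sqrt n)) : RadiallySeparated η d n z :=
  Or.inl h.le

theorem tendsto_sqrt_mul_norm_one_sub {n : ℕ → ℕ} {z : ℕ → ℂ} {z₀ : ℂ}
    (hn : Tendsto n atTop atTop) (hz : Tendsto z atTop (𝓝 z₀)) (hz₁ : z₀ ≠ 1) :
    Tendsto (fun k => Real.sqrt (n k) * ‖1 - z k‖) atTop atTop :=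
  (tendsto_sqrt_natCast.comp hn).atTop_mul_pos (norm_pos_iff.2 (sub_ne_zero.2 hz₁.symm))
    (hz.const_sub 1).norm

/-- Away from `1`, the curve modulus at the zeros satisfies
`curveModulus ^ (n / lam) ~ const * √n * |1 - z|`. -/
theorem OneDirectionGrowth.exists_tendsto_curveModulus_rpow_div
    (hf : OneDirectionGrowth a b lam θ μ f) (hlam : 0 < lam) (hθ : 0 < θ) (hθπ : θ < Real.pi)
    (hμ : μ < 1) (hdir : lam * θ < 2 * Real.pi) {n : ℕ → ℕ} {z : ℕ → ℂ} {z₀ : ℂ}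
    (hz₀ : z₀ ≠ 0) (hz₁ : z₀ ≠ 1) (harg : |Complex.arg z₀| < θ)
    (h : ZerosTendTo f lam n z z₀) :
    ∃ B > 0, Tendsto (fun k => curveModulus lam (z k) ^ ((n k : ℝ) / lam) /
      (Real.sqrt (n k) * ‖1 - z k‖)) atTop (𝓝 B) := by
  have hfar := tendsto_sqrt_mul_norm_one_sub h.1 h.2.2 hz₁
  have hin1 := hf.eventually_norm_lt_exp hlam hθ hθπ hμ hdir one_pos h
  -- The zeros lie inside radius `exp (1 / √n)`, so the contour `η = 2` encloses them with margin `d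
  -- = 1`. Any `η > 0` and smaller margin would serve here.
  have hsep : ∀ᶠ k in atTop, RadiallySeparated 2 1 (n k) (z k) := by
    filter_upwards [hin1] with k hk
    exact radiallySeparated_of_norm_lt (by norm_num; simpa using hk)
  have hin2 : ∀ᶠ k in atTop, ‖z k‖ < Real.exp (2 / Real.sqrt (n k)) := by
    filter_upwards [hin1] with k hk
    refine hk.trans_le (Real.exp_le_exp.2 ?_)
    gcongr
    norm_num
  have h1 := (hf.tendsto_cauchySaddleIntegral_far hlam hθ hθπ hμ hdir one_pos h.1 h.2.2 hsep
    hfar).norm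
  have h2 := hf.tendsto_norm_cauchySaddleIntegral_mul hlam hθπ hz₀ harg h hin2
  set B := ‖(2 * Real.pi : ℂ)⁻¹ *
    ∫ x : ℝ, Complex.exp (lam * (((2 : ℝ) : ℂ) + x * Complex.I) ^ 2 / 2)‖ with hB
  have hB0 : 0 < B := by
    rw [hB, norm_pos_iff]
    refine mul_ne_zero (inv_ne_zero ?_) (integral_saddle_gaussian_ne_zero hlam 2)
    exact_mod_cast Real.two_pi_pos.ne'
  refine ⟨‖z₀ ^ a‖ / B, div_pos (norm_pos_iff.2 (by simp [Complex.cpow_eq_zero_iff, hz₀])) hB0,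
    (h2.div h1 hB0.ne').congr' ?_⟩
  filter_upwards [h1.eventually_ne hB0.ne'] with k hk
  rw [norm_mul, norm_mul, Complex.norm_real, Real.norm_of_nonneg (Real.sqrt_nonneg _)] at hk
  simp only [Pi.div_apply]
  rw [norm_mul, norm_mul, Complex.norm_real, Real.norm_of_nonneg (Real.sqrt_nonneg _),
    mul_comm _ (curveModulus lam (z k) ^ _), mul_div_mul_right _ _ (right_ne_zero_of_mul hk)]

/-! ### Expansion of the modulus and the three assertions. -/

/-- From `(n / lam) log M = (log n) / 2 + O(1)` to an expansion of `M`. -/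
theorem isBigO_sub_of_log_asymptotics {lam β : ℝ} (hlam : 0 < lam) {n : ℕ → ℕ} {M : ℕ → ℝ}
    (hn : Tendsto n atTop atTop) (hM : ∀ᶠ k in atTop, 0 < M k)
    (h : Tendsto (fun k => (n k : ℝ) / lam * Real.log (M k) - Real.log (n k) / 2) atTop (𝓝 β)) :
    (fun k => M k - (1 + lam * Real.log (n k) / (2 * (n k : ℝ)))) =O[atTop]
      fun k => 1 / (n k : ℝ) := by
  have hnr : Tendsto (fun k => (n k : ℝ)) atTop atTop := tendsto_natCast_atTop_atTop.comp hn
  have hlin : (fun k => Real.log (M k) - lam * Real.log (n k) / (2 * (n k : ℝ))) =O[atTop]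
      fun k => 1 / (n k : ℝ) := by
    have h1 := (h.isBigO_one ℝ).mul (isBigO_refl (fun k => 1 / (n k : ℝ)) atTop)
    have h2 := h1.const_mul_left lam
    simp only [one_mul] at h2
    refine h2.congr' ?_ EventuallyEq.rfl
    filter_upwards [hn.eventually_gt_atTop 0] with k hk
    have : (0 : ℝ) < n k := by exact_mod_cast hk
    field_simp
  have hlogsq : (fun k => (Real.log (n k) / (n k : ℝ)) ^ 2) =O[atTop] fun k => 1 / (n k : ℝ) := by
    have h1 : (fun k => Real.log (n k) ^ 2) =O[atTop] fun k => (n k : ℝ) :=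
      ((Real.isLittleO_pow_log_id_atTop (n := 2)).comp_tendsto hnr).isBigO
    have h2 := h1.mul (isBigO_refl (fun k => 1 / (n k : ℝ) ^ 2) atTop)
    refine h2.congr' ?_ ?_
    · exact Eventually.of_forall fun k => by simp only []; ring
    · filter_upwards [hn.eventually_gt_atTop 0] with k hk
      have : (0 : ℝ) < n k := by exact_mod_cast hk
      field_simp
  have hinv0 : Tendsto (fun k => 1 / (n k : ℝ)) atTop (𝓝 0) := hnr.const_div_atTop 1
  have hinv : (fun k => 1 / (n k : ℝ)) =O[atTop] fun k => Real.log (n k) / (n k : ℝ) := by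
    refine IsBigO.of_bound 1 ?_
    filter_upwards [(Real.tendsto_log_atTop.comp hnr).eventually_ge_atTop 1,
      hn.eventually_gt_atTop 0] with k hk hk0
    have : (0 : ℝ) < n k := by exact_mod_cast hk0
    have hk' : 1 ≤ Real.log (n k) := hk
    rw [one_mul, Real.norm_of_nonneg (by positivity), Real.norm_of_nonneg (by positivity)]
    gcongr
  have hlog : (fun k => Real.log (M k)) =O[atTop] fun k => Real.log (n k) / (n k : ℝ) := by
    have h1 : (fun k => lam * Real.log (n k) / (2 * (n k : ℝ))) =O[atTop]
        fun k => Real.log (n k) / (n k : ℝ) :=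
      ((isBigO_refl (fun k => Real.log (n k) / (n k : ℝ)) atTop).const_mul_left (lam / 2)).congr_left
        fun k => by ring
    exact ((hlin.trans hinv).add h1).congr_left fun k => by ring
  have hlogsq' : (fun k => Real.log (M k) ^ 2) =O[atTop] fun k => 1 / (n k : ℝ) :=
    (hlog.pow 2).trans hlogsq
  have hlog0 : Tendsto (fun k => Real.log (M k)) atTop (𝓝 0) := by
    have h1 := hlogsq'.trans_tendsto hinv0
    have h2 := (Real.continuous_sqrt.tendsto 0).comp h1
    rw [Real.sqrt_zero] at h2
    rw [tendsto_zero_iff_abs_tendsto_zero]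
    exact h2.congr fun k => Real.sqrt_sq_eq_abs _
  -- Since `|e^L - 1 - L| ≤ L²` and `L = O(log n / n)`, the error is `O((log n / n)²)`, which is
  -- `O(1 / n)`.
  have hexp : (fun k => M k - 1 - Real.log (M k)) =O[atTop] fun k => 1 / (n k : ℝ) := by
    refine IsBigO.trans (IsBigO.of_bound 1 ?_) hlogsq'
    filter_upwards [hM, hlog0.abs.eventually_le_const (show |(0 : ℝ)| < 1 by norm_num)]
      with k hk hk1
    have h1 := Real.abs_exp_sub_one_sub_id_le hk1
    rw [Real.exp_log hk] at h1
    rw [one_mul, Real.norm_eq_abs, Real.norm_of_nonneg (sq_nonneg _)]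
    exact h1
  exact (hexp.add hlin).congr_left fun k => by ring

theorem OneDirectionGrowth.curveModulus_expansion
    (hf : OneDirectionGrowth a b lam θ μ f) (hlam : 0 < lam) (hθ : 0 < θ) (hθπ : θ < Real.pi)
    (hμ : μ < 1) (hdir : lam * θ < 2 * Real.pi) {n : ℕ → ℕ} {z : ℕ → ℂ} {z₀ : ℂ}
    (hz₀ : z₀ ≠ 0) (hz₁ : z₀ ≠ 1) (harg : |Complex.arg z₀| < θ)
    (h : ZerosTendTo f lam n z z₀) :
    (fun k => curveModulus lam (z k) - (1 + lam * Real.log (n k) / (2 * (n k : ℝ))))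
      =O[atTop] fun k => 1 / (n k : ℝ) := by
  obtain ⟨B, hB, hlim⟩ := hf.exists_tendsto_curveModulus_rpow_div hlam hθ hθπ hμ hdir hz₀ hz₁ harg h
  have hpos : ∀ᶠ k in atTop, 0 < curveModulus lam (z k) := by
    filter_upwards [h.2.2.eventually_ne hz₀] with k hk using curveModulus_pos lam hk
  have hd : 0 < ‖1 - z₀‖ := norm_pos_iff.2 (sub_ne_zero.2 hz₁.symm)
  have hdist := (h.2.2.const_sub 1).norm
  -- Adding `log |1 - z|` cancels the distance factor, leaving `(n / lam) log M - log √n`, which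
  -- therefore converges.
  have h1 := (((Real.continuousAt_log hB.ne').tendsto.comp hlim).add
    ((Real.continuousAt_log hd.ne').tendsto.comp hdist))
  refine isBigO_sub_of_log_asymptotics hlam h.1 hpos (h1.congr' ?_)
  filter_upwards [hpos, hdist.eventually_ne hd.ne', h.1.eventually_gt_atTop 0] with k hk hk1 hn
  have hn' : (0 : ℝ) < n k := by exact_mod_cast hn
  have hS := Real.sqrt_pos.2 hn'
  simp only [Function.comp_apply]
  rw [Real.log_div (Real.rpow_pos_of_pos hk _).ne' (mul_ne_zero hS.ne' hk1),
    Real.log_mul hS.ne' hk1, Real.log_rpow hk, Real.log_sqrt hn'.le]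
  ring

theorem OneDirectionGrowth.eventually_one_lt_curveModulus
    (hf : OneDirectionGrowth a b lam θ μ f) (hlam : 0 < lam) (hθ : 0 < θ) (hθπ : θ < Real.pi)
    (hμ : μ < 1) (hdir : lam * θ < 2 * Real.pi) {n : ℕ → ℕ} {z : ℕ → ℂ} {z₀ : ℂ}
    (hz₀ : z₀ ≠ 0) (harg : |Complex.arg z₀| < θ) (h : ZerosTendTo f lam n z z₀) :
    ∀ᶠ k in atTop, 1 < curveModulus lam (z k) := by
  -- A modulus at most `1` has `n / lam`-th power at most `1`, so it suffices to contradict that.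
  -- The premise is kept for the case `z₀ = 1`, where the power is not shown to be large outright.
  suffices hrpow : ∀ᶠ k in atTop, curveModulus lam (z k) ≤ 1 →
      1 < curveModulus lam (z k) ^ ((n k : ℝ) / lam) by
    filter_upwards [hrpow] with k hk
    by_contra hle
    have hle' := not_lt.1 hle
    exact (hk hle').not_ge (Real.rpow_le_one (norm_nonneg _) hle' (by positivity))
  by_cases hz₁ : z₀ = 1
  · subst hz₁
    -- This `η` minimises `exp (lam η² / 2) √(2π / lam) / (2π η)`, the bound for `|J|` with full
    -- margin `η`; the minimum `√(e / 2π)` is about `0.66`. Keeping margin `3/4 η`, reduced to `7/10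
    -- η` for the kernel, still gives a value below `1`, because `e < 0.98 π`.
    set η := (Real.sqrt lam)⁻¹ with hη
    have hsl : 0 < Real.sqrt lam := Real.sqrt_pos.2 hlam
    have hη0 : 0 < η := by positivity
    have hηsq : lam * η ^ 2 = 1 := by
      rw [hη, inv_pow, Real.sq_sqrt hlam.le, mul_inv_cancel₀ hlam.ne']
    have hin := hf.eventually_norm_lt_exp hlam hθ hθπ hμ hdir (ξ := η - 3 / 4 * η)
      (by linarith) h
    have hin2 : ∀ᶠ k in atTop, ‖z k‖ < Real.exp (η / Real.sqrt (n k)) := by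
      filter_upwards [hin] with k hk
      refine hk.trans_le (Real.exp_le_exp.2 ?_)
      gcongr
      linarith
    have hconst : Real.exp (lam * η ^ 2 / 2) * Real.sqrt (2 * Real.pi / lam) <
        2 * Real.pi * (7 / 10 * η) * 1 := by
      refine lt_of_pow_lt_pow_left₀ 2 (by positivity) ?_
      rw [hηsq, mul_pow, ← Real.exp_nat_mul, Real.sq_sqrt (by positivity)]
      have h1 : ((2 : ℕ) : ℝ) * (1 / 2) = 1 := by norm_num
      have h2 : 2 * Real.pi / lam = 2 * Real.pi * η ^ 2 := by
        rw [div_eq_iff hlam.ne', mul_assoc, mul_comm (η ^ 2), hηsq, mul_one]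
      rw [h1, h2]
      have h3 := Real.exp_one_lt_d9
      have h4 := Real.pi_gt_d2
      have h5 : Real.exp 1 < 98 / 100 * Real.pi := by linarith
      have h6 : 0 < 2 * Real.pi * η ^ 2 := by positivity
      nlinarith
    have hconst' : ∃ M < 1, Real.exp (lam * η ^ 2 / 2) * Real.sqrt (2 * Real.pi / lam) <
        2 * Real.pi * (7 / 10 * η) * M := by
      have hp : 0 < 2 * Real.pi * (7 / 10 * η) := by positivity
      rw [mul_one] at hconst
      obtain ⟨M, hM1, hM2⟩ := exists_between ((div_lt_one hp).2 hconst)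
      exact ⟨M, hM2, (div_lt_iff₀' hp).1 hM1⟩
    obtain ⟨M, hM1, hM⟩ := hconst'
    have hJ := h.1.eventually (hf.eventually_norm_cauchySaddleIntegral_le hlam hθ hθπ hμ hdir
      (d := 3 / 4 * η) (d' := 7 / 10 * η) (by positivity) (by linarith) hM)
    have h2 := hf.tendsto_norm_cauchySaddleIntegral_mul hlam hθπ one_ne_zero harg h hin2
    rw [Complex.one_cpow, norm_one] at h2
    filter_upwards [hJ, hin, h2.eventually_const_lt hM1] with k hk hink hgt hle
    have h3 := hk _ (radiallySeparated_of_norm_lt hink)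
    have h4 := Real.rpow_le_one (norm_nonneg _) hle
      (show 0 ≤ (n k : ℝ) / lam by positivity)
    have h5 : ‖cauchySaddleIntegral f a b lam η (n k) (z k)‖ *
        curveModulus lam (z k) ^ ((n k : ℝ) / lam) ≤ M :=
      (mul_le_of_le_one_right (norm_nonneg _) h4).trans h3
    exact absurd h5 (not_le.2 hgt)
  · obtain ⟨B, hB, hlim⟩ :=
      hf.exists_tendsto_curveModulus_rpow_div hlam hθ hθπ hμ hdir hz₀ hz₁ harg h
    have hfar := tendsto_sqrt_mul_norm_one_sub h.1 h.2.2 hz₁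
    have h1 := hlim.pos_mul_atTop hB hfar
    filter_upwards [h1.eventually_gt_atTop 1, hfar.eventually_gt_atTop 0] with k hk hk0 _
    rwa [div_mul_cancel₀ _ hk0.ne'] at hk

theorem OneDirectionGrowth.mem_limitCurve
    (hf : OneDirectionGrowth a b lam θ μ f) (hlam : 0 < lam) (hθ : 0 < θ) (hθπ : θ < Real.pi)
    (hμ : μ < 1) (hdir : lam * θ < 2 * Real.pi) {z₀ : ℂ}
    (hz₀ : z₀ ≠ 0) (harg : |Complex.arg z₀| < θ) (h : IsZeroLimitPoint f lam z₀) :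
    z₀ ∈ limitCurve lam := by
  obtain ⟨n, z, h⟩ := h
  refine ⟨?_, hf.norm_le_one_of_zerosTendTo hlam hθ hθπ hμ hdir h⟩
  by_cases hz₁ : z₀ = 1
  · rw [hz₁, curveModulus_one]
  have hnr : Tendsto (fun k => (n k : ℝ)) atTop atTop := tendsto_natCast_atTop_atTop.comp h.1
  have h1 := (hf.curveModulus_expansion hlam hθ hθπ hμ hdir hz₀ hz₁ harg h).trans_tendsto
    (hnr.const_div_atTop 1)
  have h2 : Tendsto (fun k => lam * Real.log (n k) / (2 * (n k : ℝ))) atTop (𝓝 0) := by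
    have h3 := (Real.isLittleO_log_id_atTop.tendsto_div_nhds_zero.comp hnr).const_mul (lam / 2)
    rw [mul_zero] at h3
    refine h3.congr fun k => ?_
    simp only [Function.comp_apply, id]
    ring
  have h4 := h1.add (h2.const_add 1)
  simp only [sub_add_cancel, add_zero, zero_add] at h4
  exact tendsto_nhds_unique ((continuousAt_curveModulus lam
    (mem_slitPlane_of_abs_arg_lt hθπ hz₀ harg)).tendsto.comp h.2.2) h4

end Zeros

theorem mainTheorem3 (a b : ℂ) (lam θ μ : ℝ) (hlam : 0 < lam) (hθ : 0 < θ) (hθπ : θ < Real.pi)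
    (hμ : μ < 1) (hdir : lam * θ < 2 * Real.pi)
    (f : ℂ → ℂ) (hf : OneDirectionGrowth a b lam θ μ f) :
    (∀ z₀ : ℂ, |Complex.arg z₀| < θ → z₀ ≠ 0 → IsZeroLimitPoint f lam z₀ →
      z₀ ∈ limitCurve lam) ∧
    (∀ (n : ℕ → ℕ) (z : ℕ → ℂ) (z₀ : ℂ), |Complex.arg z₀| < θ → z₀ ≠ 0 →
      ZerosTendTo f lam n z z₀ →
        ∀ᶠ k in atTop, 1 < curveModulus lam (z k)) ∧
    (∀ (n : ℕ → ℕ) (z : ℕ → ℂ) (z₀ : ℂ), |Complex.arg z₀| < θ → z₀ ≠ 0 → z₀ ≠ 1 →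
      ZerosTendTo f lam n z z₀ →
        (fun k => curveModulus lam (z k) - (1 + lam * Real.log (n k) / (2 * (n k : ℝ))))
          =O[atTop] fun k => 1 / (n k : ℝ)) := by
  refine ⟨fun z₀ harg hz₀ h => ?_, fun n z z₀ harg hz₀ h => ?_,
    fun n z z₀ harg hz₀ hz₁ h => ?_⟩
  · exact hf.mem_limitCurve hlam hθ hθπ hμ hdir hz₀ harg h
  · exact hf.eventually_one_lt_curveModulus hlam hθ hθπ hμ hdir hz₀ harg h
  · exact hf.curveModulus_expansion hlam hθ hθπ hμ hdir hz₀ hz₁ harg h
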